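/- Let $D\subsetneq\mathbb{C}$ be a simply connected domain, let $F$ and $G$ be holomorphic functions on $D$ with $F\not\equiv 0$, and put $\|G\|_\infty:=\sup_{w\in D}|G(w)|$. For $\theta\in\mathbb{R}/2\pi\mathbb{Z}$, $\lambda\in(0,\infty)$ and $c\in\mathbb{R}$ let $$X_{\theta,\lambda,c}=\operatorname{Re}\int^w\begin{pmatrix}1-c\lambda^2G^2\\-i(1+c\lambda^2G^2)\\2\lambda G\end{pmatrix}\frac{e^{i\theta}}{\lambda}F\,dw\colon D\to\mathbb{R}^3$$ (which is determined up to a translation), and let $S_{\theta,\lambda,c}=X_{\theta,\lambda,c}(D)$ be its image. A set $S\subset\mathbb{R}^3$ is called a graph over a domain $\Omega\subset\mathbb{R}^2\cong\mathbb{C}$ if $S=\{(x,y,\phi(x,y)) : (x,y)\in\Omega\}$ for some function $\phi\colon\Omega\to\mathbb{R}$. A domain $\Omega\subset\mathbb{C}$ is called close-to-convex if $\mathbb{C}\setminus\Omega$ is a union of closed half lines that are pairwise disjoint except possibly for their initial points (the initial point of one half line may lie on another one). Suppose that $G$ is not constant and that $|G|<1$ on $D$. If $\theta_0\in\mathbb{R}/2\pi\mathbb{Z}$,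 $\lambda_0>0$ and $c_0\in\mathbb{R}$ satisfy $|c_0\lambda_0^2|\le 1/\|G\|_\infty^2$ and $S_{\theta_0,\lambda_0,c_0}$ is a graph over a convex domain, then $S_{\theta,\lambda,c}$ is a graph over a close-to-convex domain for all $\theta\in\mathbb{R}/2\pi\mathbb{Z}$, $\lambda>0$ and $c\in\mathbb{R}$ with $|c\lambda^2|\le|c_0\lambda_0^2|$. -/

import Mathlib

open Set

/-- The supremum norm `sup_{w ∈ D} |G w|` of a function `G` that is bounded on `D`. -/
noncomputable def supNormOn (D : Set ℂ) (G : ℂ → ℂ) : ℝ :=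
  sSup ((fun w => ‖G w‖) '' D)

/-- `X : D → ℝ³ ≅ ℂ × ℝ` is the surface
`X = Re ∫^w (1 - c l² G², -i (1 + c l² G²), 2 l G) (e^{iθ} / l) F dw`,
where `(x, y, t)` is identified with `(x + i y, t)`. The indefinite integrals are holomorphic
primitives `Ψ₁, Ψ₂, Ψ₃` of the three integrands on `D`, so that the surface is determined up to a
translation when `D` is connected. Only the values of `X` on `D` matter. -/
def IsDeformedSurface (D : Set ℂ) (F G : ℂ → ℂ) (θ l c : ℝ) (X : ℂ → ℂ × ℝ) : Prop :=
  ∃ Ψ₁ Ψ₂ Ψ₃ : ℂ → ℂ,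
    (∀ w ∈ D, HasDerivAt Ψ₁
      ((1 - c * l ^ 2 * G w ^ 2) * (Complex.exp (Complex.I * θ) / l) * F w) w) ∧
    (∀ w ∈ D, HasDerivAt Ψ₂
      (-Complex.I * (1 + c * l ^ 2 * G w ^ 2) * (Complex.exp (Complex.I * θ) / l) * F w) w) ∧
    (∀ w ∈ D, HasDerivAt Ψ₃
      (2 * l * G w * (Complex.exp (Complex.I * θ) / l) * F w) w) ∧
    ∀ w ∈ D, X w = ((⟨(Ψ₁ w).re, (Ψ₂ w).re⟩ : ℂ), (Ψ₃ w).re)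

/-- The set `S ⊆ ℝ³ ≅ ℂ × ℝ` is the graph `{(x, y, φ (x, y)) | (x, y) ∈ Ω}` of a real function `φ`
on the domain (nonempty connected open set) `Ω` of the `xy`-plane. -/
def IsGraphOverDomain (S : Set (ℂ × ℝ)) (Ω : Set ℂ) : Prop :=
  IsOpen Ω ∧ IsConnected Ω ∧ ∃ φ : ℂ → ℝ, S = {p | p.1 ∈ Ω ∧ p.2 = φ p.1}

/-- The closed half line with initial point `a` and direction `v`. -/
def closedHalfLine (a v : ℂ) : Set ℂ := {z | ∃ s : ℝ, 0 ≤ s ∧ z = a + s * v}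

/-- The half line with initial point `a` and direction `v`, without its initial point. -/
def openHalfLine (a v : ℂ) : Set ℂ := {z | ∃ s : ℝ, 0 < s ∧ z = a + s * v}

/-- A planar set is close-to-convex if its complement is a union of half lines that are disjoint
except possibly for their initial points, i.e. a point common to two of the half lines is the
initial point of at least one of them. A half line is given by its initial point and a nonzero
direction vector. -/
def IsCloseToConvex (Ω : Set ℂ) : Prop :=
  ∃ R : Set (ℂ × ℂ), (∀ r ∈ R, r.2 ≠ 0) ∧
    Ωᶜ = (⋃ r ∈ R, closedHalfLine r.1 r.2) ∧
    R.Pairwise fun r s => Disjoint (openHalfLine r.1 r.2) (openHalfLine s.1 s.2)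

/-! ### Monotone variational inequalities on compact convex sets. -/

section VariationalInequality

open scoped InnerProductSpace Topology
open Filter

variable {E : Type*} [NormedAddCommGroup E] [InnerProductSpace ℝ E]

/-! The horizontal projection of a surface in the family is a harmonic map `f = h - conj k`, where
`h'` is a nonzero constant times `F` and `k' = μ h'` with `μ = c λ² G²`. The bound on `c₀ λ₀²`,
together with the maximum principle for `G`, gives `|μ| < 1` for the initial surface. Changing the
parameters multiplies `h` by a constant `κ` and `k` by `κ r` with `r` real, `|r| ≤ 1`, up to
additive constants. Since `conj k = h - f`, the new projection is `κ ((1 - ε) h + ε f)` plus a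
constant, where `κ ε = conj κ r` and so `|ε| ≤ 1`.

As `F` may vanish and only the image of the surface is a graph, `f` is not assumed injective. The
gradient of the graph function nevertheless determines `G` by a quadratic equation
(`gauss_eq_of_graph`), so `G` descends to the convex set `Ω₀ = f(D)`. There the differentials of `h`
and of the height become continuous 1-forms, closed off the countable set of critical values. The
Poincaré lemma `exists_primitive_of_off_countable` then makes `h` and the height functions of `f`
(`exists_factor_of_graph`). The new projection is thus `Φ ∘ f` with `Φ` on `Ω₀`. The differential of
the factor of `h` has real part above `1/2` in every direction, so after a rotation `Φ` is a
strictly monotone field (`isCloseToConvex_image_of_beltrami`). Hence `Φ` is injective, and the new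
surface is a graph over `Φ(Ω₀)`.

Finally, a strictly monotone image of a convex domain is close-to-convex. On a compact convex `K`,
each `p` outside the image has a unique `x` for which `p - f x` is an outer normal to `K` at `x`.
The ray from `p` in that direction keeps the same `x`, so it avoids the image, and rays that meet
have the same direction. Exhausting the domain by polygons, passing to limit directions and merging
overlapping rays gives the half lines. -/

theorem max_zero_add_sq_le (u d : ℝ) :
    max 0 (u + d) ^ 2 ≤ max 0 u ^ 2 + 2 * max 0 u * d + d ^ 2 := by
  have h1 : max 0 (u + d) ≤ |max 0 u + d| := by
    refine max_le (abs_nonneg _) ((add_le_add_left (le_max_right 0 u) d).trans (le_abs_self _))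
  have h2 := pow_le_pow_left₀ (le_max_left 0 (u + d)) h1 2
  rw [sq_abs] at h2
  linarith

/-- A finite monotone family `(y i, a i)` admits a point `x` of a compact convex set containing
all the `y i` with `⟪a i, y i - x⟫ ≥ 0` for all `i`. -/
theorem exists_forall_inner_sub_nonneg {ι : Type*} {K : Set E} (hK : IsCompact K)
    (hKc : Convex ℝ K) (hKn : K.Nonempty) (s : Finset ι) (y a : ι → E) (hy : ∀ i ∈ s, y i ∈ K)
    (hmon : ∀ i ∈ s, ∀ j ∈ s, 0 ≤ ⟪a i - a j, y i - y j⟫_ℝ) :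
    ∃ x ∈ K, ∀ i ∈ s, 0 ≤ ⟪a i, y i - x⟫_ℝ := by
  -- Minimise the total squared violation of the desired inequalities; the claim is that its minimum
  -- is zero.
  obtain ⟨x, hx, hmin⟩ := hK.exists_isMinOn hKn
    (f := fun x => ∑ i ∈ s, max 0 ⟪a i, x - y i⟫_ℝ ^ 2) (by fun_prop)
  refine ⟨x, hx, ?_⟩
  set m : ι → ℝ := fun i => max 0 ⟪a i, x - y i⟫_ℝ with hm
  have hm0 : ∀ i, 0 ≤ m i := fun i => le_max_left _ _
  -- First-order condition at the minimiser. The quadratic bound `max_zero_add_sq_le` replaces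
  -- differentiation of the squared positive part.
  have hfirst : ∀ z ∈ K, 0 ≤ ∑ i ∈ s, m i * ⟪a i, z - x⟫_ℝ := by
    intro z hz
    by_contra! hneg
    set A := ∑ i ∈ s, m i * ⟪a i, z - x⟫_ℝ
    set B := ∑ i ∈ s, ⟪a i, z - x⟫_ℝ ^ 2
    have hB : 0 ≤ B := Finset.sum_nonneg fun i _ => sq_nonneg _
    have key : ∀ r : ℝ, 0 ≤ r → r ≤ 1 → 0 ≤ 2 * r * A + r ^ 2 * B := by
      intro r hr0 hr1
      have hmem : x + r • (z - x) ∈ K := hKc.add_smul_sub_mem hx hz ⟨hr0, hr1⟩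
      have h1 := hmin hmem
      simp only [mem_ofPred_eq] at h1
      have h2 : ∑ i ∈ s, max 0 ⟪a i, x + r • (z - x) - y i⟫_ℝ ^ 2 ≤
          ∑ i ∈ s, (m i ^ 2 + 2 * r * (m i * ⟪a i, z - x⟫_ℝ) + r ^ 2 * ⟪a i, z - x⟫_ℝ ^ 2) := by
        refine Finset.sum_le_sum fun i _ => ?_
        have h3 := max_zero_add_sq_le ⟪a i, x - y i⟫_ℝ (r * ⟪a i, z - x⟫_ℝ)
        have h4 : ⟪a i, x + r • (z - x) - y i⟫_ℝ = ⟪a i, x - y i⟫_ℝ + r * ⟪a i, z - x⟫_ℝ := by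
          rw [← real_inner_smul_right, ← inner_add_right]
          congr 1; abel
        rw [h4]
        refine h3.trans (le_of_eq ?_)
        simp only [hm]; ring
      rw [Finset.sum_add_distrib, Finset.sum_add_distrib, ← Finset.mul_sum, ← Finset.mul_sum] at h2
      linarith
    have hpos : 0 < min 1 (-A / (B + 1)) := lt_min one_pos (div_pos (by linarith) (by linarith))
    have h5 := key _ hpos.le (min_le_left _ _)
    set r := min 1 (-A / (B + 1))
    have h6 : r * (B + 1) ≤ -A := by
      rw [← le_div_iff₀ (by linarith)]; exact min_le_right _ _
    have h7 : 0 ≤ 2 * A + r * B := by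
      by_contra! h
      nlinarith
    nlinarith
  set L := ∑ i ∈ s, m i with hL
  have hL0 : 0 ≤ L := Finset.sum_nonneg fun i _ => hm0 i
  have hmz : ∀ i ∈ s, m i = 0 := by
    rcases hL0.eq_or_lt with h | h
    · exact (Finset.sum_eq_zero_iff_of_nonneg fun i _ => hm0 i).1 h.symm
    -- Test with the barycentre of the `y i` for the weights `m i`. By monotonicity the symmetrised
    -- double sum is nonpositive, which leaves `0 ≤ -L ∑ m i ^ 2`.
    · have hc := hKc.centerMass_mem (fun i _ => hm0 i) h hy
      have h1 := hfirst _ hc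
      have h2 : ∀ i, L * ⟪a i, s.centerMass m y - x⟫_ℝ = ∑ j ∈ s, m j * ⟪a i, y j - x⟫_ℝ := by
        intro i
        rw [Finset.centerMass, inner_sub_right, inner_smul_right, inner_sum, mul_sub, ← hL,
          ← mul_assoc, mul_inv_cancel₀ h.ne', one_mul, hL, Finset.sum_mul,
          ← Finset.sum_sub_distrib]
        refine Finset.sum_congr rfl fun j _ => ?_
        rw [inner_smul_right, inner_sub_right]; ring
      have h3 : 0 ≤ ∑ i ∈ s, ∑ j ∈ s, m i * m j * ⟪a i, y j - x⟫_ℝ := by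
        have := mul_nonneg hL0 h1
        rw [Finset.mul_sum] at this
        refine this.trans (le_of_eq (Finset.sum_congr rfl fun i _ => ?_))
        rw [mul_left_comm, h2, Finset.mul_sum]
        exact Finset.sum_congr rfl fun j _ => by ring
      have h4 : ∑ i ∈ s, ∑ j ∈ s, m i * m j * ⟪a i, y j - x⟫_ℝ =
          ∑ i ∈ s, ∑ j ∈ s, m i * m j * ⟪a i, y j - y i⟫_ℝ - L * ∑ i ∈ s, m i ^ 2 := by
        rw [Finset.mul_sum, ← Finset.sum_sub_distrib]
        refine Finset.sum_congr rfl fun i _ => ?_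
        have h5 : m i ^ 2 = m i * ⟪a i, x - y i⟫_ℝ := by
          simp only [hm]
          rcases le_total 0 ⟪a i, x - y i⟫_ℝ with h | h
          · rw [max_eq_right h]; ring
          · rw [max_eq_left h]; ring
        rw [h5, hL, Finset.sum_mul, ← Finset.sum_sub_distrib]
        refine Finset.sum_congr rfl fun j _ => ?_
        simp only [inner_sub_right]; ring
      have h5 : ∑ i ∈ s, ∑ j ∈ s, m i * m j * ⟪a i, y j - y i⟫_ℝ ≤ 0 := by
        have h6 : ∑ i ∈ s, ∑ j ∈ s, m i * m j * ⟪a i, y j - y i⟫_ℝ +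
            ∑ i ∈ s, ∑ j ∈ s, m i * m j * ⟪a i, y j - y i⟫_ℝ =
            - ∑ i ∈ s, ∑ j ∈ s, m i * m j * ⟪a i - a j, y i - y j⟫_ℝ := by
          nth_rw 2 [Finset.sum_comm]
          simp only [← Finset.sum_add_distrib, ← Finset.sum_neg_distrib]
          refine Finset.sum_congr rfl fun i _ => Finset.sum_congr rfl fun j _ => ?_
          simp only [inner_sub_right, inner_sub_left]; ring
        have h7 : 0 ≤ ∑ i ∈ s, ∑ j ∈ s, m i * m j * ⟪a i - a j, y i - y j⟫_ℝ :=
          Finset.sum_nonneg fun i hi => Finset.sum_nonneg fun j hj =>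
            mul_nonneg (mul_nonneg (hm0 i) (hm0 j)) (hmon i hi j hj)
        linarith
      have h8 : ∑ i ∈ s, m i ^ 2 ≤ 0 := by
        by_contra! h9
        have := mul_pos h h9
        linarith
      have h10 := (Finset.sum_eq_zero_iff_of_nonneg (fun i _ => sq_nonneg (m i))).1
        (h8.antisymm (Finset.sum_nonneg fun i _ => sq_nonneg (m i)))
      exact fun i hi => by simpa using h10 i hi
  intro i hi
  have h1 : ⟪a i, x - y i⟫_ℝ ≤ 0 := by
    have := hmz i hi
    simp only [hm] at this
    exact this ▸ le_max_right _ _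
  rw [← neg_sub, inner_neg_right]
  linarith

/-- Existence of solutions of monotone variational inequalities on compact convex sets. -/
theorem exists_variationalInequality {K : Set E} (hK : IsCompact K) (hKc : Convex ℝ K)
    (hKn : K.Nonempty) {f : E → E} (hf : ContinuousOn f K)
    (hmon : ∀ x ∈ K, ∀ y ∈ K, 0 ≤ ⟪f x - f y, x - y⟫_ℝ) (p : E) :
    ∃ x ∈ K, ∀ y ∈ K, 0 ≤ ⟪f x - p, y - x⟫_ℝ := by
  -- Minty's form, with `f` evaluated at the test point: each condition is closed in `x`, so
  -- compactness reduces to finitely many `y`.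
  have hminty : ∃ x ∈ K, ∀ y ∈ K, 0 ≤ ⟪f y - p, y - x⟫_ℝ := by
    have h := hK.inter_iInter_nonempty (fun y : K => {x | 0 ≤ ⟪f y - p, y - x⟫_ℝ})
      (fun y => isClosed_le continuous_const (by fun_prop)) ?_
    · obtain ⟨x, hx, hx'⟩ := h
      rw [mem_iInter] at hx'
      exact ⟨x, hx, fun y hy => hx' ⟨y, hy⟩⟩
    · intro u
      obtain ⟨x, hx, hx'⟩ := exists_forall_inner_sub_nonneg hK hKc hKn u (fun y : K => (y : E))
        (fun y => f y - p) (fun i _ => i.2) (fun i _ j _ => by simpa using hmon i i.2 j j.2)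
      exact ⟨x, hx, mem_iInter₂.2 hx'⟩
  obtain ⟨x, hx, hx'⟩ := hminty
  refine ⟨x, hx, fun y hy => ?_⟩
  have hmem : ∀ r ∈ Ioc (0 : ℝ) 1, x + r • (y - x) ∈ K := fun r hr =>
    hKc.add_smul_sub_mem hx hy ⟨hr.1.le, hr.2⟩
  -- Return from `f y` to `f x`: test at `x + r (y - x)`, cancel `r`, and let `r` decrease to `0`.
  have hlim : Tendsto (fun r : ℝ => ⟪f (x + r • (y - x)) - p, y - x⟫_ℝ) (𝓝[Ioc 0 1] 0)
      (𝓝 ⟪f x - p, y - x⟫_ℝ) := by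
    have h1 : Tendsto (fun r : ℝ => x + r • (y - x)) (𝓝[Ioc 0 1] 0) (𝓝[K] x) := by
      refine tendsto_nhdsWithin_iff.2 ⟨?_, eventually_nhdsWithin_of_forall hmem⟩
      have : Continuous fun r : ℝ => x + r • (y - x) := by fun_prop
      simpa using (this.tendsto 0).mono_left (nhdsWithin_le_nhds (s := Ioc 0 1))
    exact (((hf x hx).tendsto.comp h1).sub_const p).inner tendsto_const_nhds
  have : (𝓝[Ioc (0 : ℝ) 1] 0).NeBot := by
    rw [nhdsWithin_Ioc_eq_nhdsGT one_pos]; infer_instance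
  refine ge_of_tendsto hlim (eventually_nhdsWithin_of_forall fun r hr => ?_)
  have h2 := hx' _ (hmem r hr)
  rw [add_sub_cancel_left, inner_smul_right] at h2
  exact nonneg_of_mul_nonneg_right h2 hr.1

end VariationalInequality

/-! ### Images of strictly monotone fields and rays in their complements. -/

section MonotoneImage

open scoped InnerProductSpace Topology
open Filter

variable {E : Type*} [NormedAddCommGroup E] [InnerProductSpace ℝ E]

/-- Strict monotonicity of a vector field on a set. -/
def StrictMonotoneField (f : E → E) (s : Set E) : Prop :=
  ∀ x ∈ s, ∀ y ∈ s, x ≠ y → 0 < ⟪f x - f y, x - y⟫_ℝ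

theorem StrictMonotoneField.mono {f : E → E} {s t : Set E} (h : StrictMonotoneField f t)
    (hst : s ⊆ t) : StrictMonotoneField f s :=
  fun x hx y hy hxy => h x (hst hx) y (hst hy) hxy

theorem StrictMonotoneField.nonneg {f : E → E} {s : Set E} (h : StrictMonotoneField f s) :
    ∀ x ∈ s, ∀ y ∈ s, 0 ≤ ⟪f x - f y, x - y⟫_ℝ := by
  intro x hx y hy
  rcases eq_or_ne x y with rfl | hxy
  · simp
  · exact (h x hx y hy hxy).le

theorem StrictMonotoneField.injOn {f : E → E} {s : Set E} (h : StrictMonotoneField f s) :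
    InjOn f s := by
  intro x hx y hy hxy
  by_contra hne
  simpa [hxy] using h x hx y hy hne

/-- Test each inequality at the other solution and add: `p` cancels and strict monotonicity is
contradicted. -/
theorem StrictMonotoneField.eq_of_variationalInequality {f : E → E} {K : Set E}
    (h : StrictMonotoneField f K) {p x y : E} (hx : x ∈ K) (hy : y ∈ K)
    (hx' : ∀ z ∈ K, 0 ≤ ⟪f x - p, z - x⟫_ℝ) (hy' : ∀ z ∈ K, 0 ≤ ⟪f y - p, z - y⟫_ℝ) : x = y := by
  by_contra hne
  have h1 := h x hx y hy hne
  have h2 := hx' y hy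
  have h3 := hy' x hx
  simp only [inner_sub_left, inner_sub_right] at h1 h2 h3
  linarith

/-- The variational inequality on a small closed ball takes the place of invariance of domain: for
`p` near `f x` its solution is interior, and there it solves `f y = p`. -/
theorem StrictMonotoneField.isOpen_image [ProperSpace E] {f : E → E} {U : Set E}
    (h : StrictMonotoneField f U) (hf : ContinuousOn f U) (hU : IsOpen U) : IsOpen (f '' U) := by
  rw [isOpen_iff_mem_nhds]
  rintro _ ⟨x, hx, rfl⟩
  obtain ⟨r, hr, hrU⟩ := Metric.nhds_basis_closedBall.mem_iff.1 (hU.mem_nhds hx)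
  have hS : ∃ m > 0, ∀ y ∈ Metric.sphere x r, m ≤ ⟪f y - f x, y - x⟫_ℝ := by
    rcases (Metric.sphere x r).eq_empty_or_nonempty with he | hne
    · exact ⟨1, one_pos, by simp [he]⟩
    · have hsU : Metric.sphere x r ⊆ U := Metric.sphere_subset_closedBall.trans hrU
      obtain ⟨y, hy, hmin⟩ := (isCompact_sphere x r).exists_isMinOn hne
        (f := fun y => ⟪f y - f x, y - x⟫_ℝ)
        (((hf.mono hsU).sub continuousOn_const).inner (by fun_prop))
      refine ⟨_, h y (hsU hy) x hx (Metric.ne_of_mem_sphere hy hr.ne'), fun z hz => hmin hz⟩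
  obtain ⟨m, hm, hmS⟩ := hS
  -- A solution `y` on the sphere, tested against the centre, would give `m ≤ ⟪p - f x, y - x⟫ ≤ ‖p
  -- - f x‖ r < m`.
  refine Metric.mem_nhds_iff.2 ⟨m / r, div_pos hm hr, fun p hp => ?_⟩
  obtain ⟨y, hy, hvi⟩ := exists_variationalInequality (isCompact_closedBall x r)
    (convex_closedBall x r) (Metric.nonempty_closedBall.2 hr.le) (hf.mono hrU)
    (h.mono hrU).nonneg p
  have hyr : dist y x < r := by
    refine lt_of_le_of_ne hy fun heq => ?_
    have h1 := hmS y heq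
    have h2 := hvi x (Metric.mem_closedBall_self hr.le)
    have h3 : ⟪p - f x, y - x⟫_ℝ ≤ ‖p - f x‖ * ‖y - x‖ := real_inner_le_norm _ _
    have h4 : ⟪f y - p, x - y⟫_ℝ = ⟪p - f x, y - x⟫_ℝ - ⟪f y - f x, y - x⟫_ℝ := by
      simp only [inner_sub_left, inner_sub_right]; ring
    rw [← dist_eq_norm, ← dist_eq_norm, heq] at h3
    rw [Metric.mem_ball, lt_div_iff₀ hr] at hp
    linarith
  refine ⟨y, hrU hy, ?_⟩
  have hball : ∀ᶠ s in 𝓝 (0 : ℝ), y - s • (f y - p) ∈ Metric.ball x r := by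
    have : ContinuousAt (fun s : ℝ => y - s • (f y - p)) 0 := by fun_prop
    exact this (Metric.isOpen_ball.mem_nhds (by simpa using hyr))
  obtain ⟨s, hs, hs0⟩ := ((hball.filter_mono nhdsWithin_le_nhds).and
    (self_mem_nhdsWithin : Ioi (0 : ℝ) ∈ 𝓝[>] 0)).exists
  have h5 := hvi _ (Metric.ball_subset_closedBall hs)
  have h6 : y - s • (f y - p) - y = -(s • (f y - p)) := by abel
  rw [h6, inner_neg_right, inner_smul_right, real_inner_self_eq_norm_sq] at h5
  have hs0' : 0 < s := hs0
  have h7 : ‖f y - p‖ ^ 2 ≤ 0 := by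
    by_contra! hh
    have := mul_pos hs0' hh
    linarith
  have h8 : ‖f y - p‖ = 0 := by
    have := sq_nonneg ‖f y - p‖
    exact pow_eq_zero_iff two_ne_zero |>.1 (le_antisymm h7 this)
  exact sub_eq_zero.1 (norm_eq_zero.1 h8)

/-- The complement of the image of a compact convex set under a strictly monotone field is swept
out by rays which meet only if they have the same direction. -/
theorem StrictMonotoneField.exists_rays_of_isCompact {f : E → E} {K : Set E}
    (h : StrictMonotoneField f K) (hf : ContinuousOn f K) (hK : IsCompact K) (hKc : Convex ℝ K)
    (hKn : K.Nonempty) :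
    ∃ v : E → E, (∀ p ∉ f '' K, ‖v p‖ = 1) ∧
      (∀ p ∉ f '' K, ∀ s : ℝ, 0 ≤ s → p + s • v p ∉ f '' K) ∧
      ∀ p ∉ f '' K, ∀ q ∉ f '' K, ∀ s t : ℝ, 0 < s → 0 < t →
        p + s • v p = q + t • v q → v p = v q := by
  choose x hx hvi using exists_variationalInequality hK hKc hKn hf h.nonneg
  have hne : ∀ p ∉ f '' K, 0 < ‖p - f (x p)‖ := fun p hp =>
    norm_pos_iff.2 (sub_ne_zero.2 fun he => hp ⟨x p, hx p, he.symm⟩)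
  set v : E → E := fun p => ‖p - f (x p)‖⁻¹ • (p - f (x p)) with hv
  have hpt : ∀ p ∉ f '' K, p = f (x p) + ‖p - f (x p)‖ • v p := by
    intro p hp
    simp only [hv]
    rw [smul_inv_smul₀ (hne p hp).ne']
    abel
  have hv1 : ∀ p ∉ f '' K, ‖v p‖ = 1 := by
    intro p hp
    simp only [hv]
    rw [norm_smul, norm_inv, norm_norm, inv_mul_cancel₀ (hne p hp).ne']
  -- Moving `p` along its ray multiplies `f (x p) - p` by a positive factor, so `x p` solves the
  -- inequality for every point of the ray. Uniqueness then gives both remaining claims.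
  have hray : ∀ p ∉ f '' K, ∀ s : ℝ, 0 ≤ s → ∀ z ∈ K,
      0 ≤ ⟪f (x p) - (p + s • v p), z - x p⟫_ℝ := by
    intro p hp s hs z hz
    have h1 : f (x p) - (p + s • v p) = (1 + s * ‖p - f (x p)‖⁻¹) • (f (x p) - p) := by
      simp only [hv]; module
    rw [h1, real_inner_smul_left]
    exact mul_nonneg (by have := hne p hp; positivity) (hvi p z hz)
  refine ⟨v, hv1, fun p hp s hs => ?_, ?_⟩
  · rintro ⟨y, hy, hyp⟩
    have h1 : x p = y := by
      refine h.eq_of_variationalInequality (hx p) hy (hray p hp s hs) (fun z _ => ?_)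
      rw [hyp]; simp
    have h2 : f (x p) + (‖p - f (x p)‖ + s) • v p = f (x p) := by
      rw [add_smul, ← add_assoc, ← hpt p hp, ← hyp, h1]
    rw [add_eq_left, smul_eq_zero] at h2
    rcases h2 with h2 | h2
    · have := hne p hp; linarith
    · simpa [h2] using hv1 p hp
  · intro p hp q hq s t hs ht heq
    have h1 : x p = x q := by
      refine h.eq_of_variationalInequality (hx p) (hx q) (hray p hp s hs.le) ?_
      rw [heq]
      exact hray q hq t ht.le
    have h2 : (‖p - f (x p)‖ + s) • v p = (‖q - f (x q)‖ + t) • v q := by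
      have h3 : f (x p) + (‖p - f (x p)‖ + s) • v p = f (x q) + (‖q - f (x q)‖ + t) • v q := by
        rw [add_smul, add_smul, ← add_assoc, ← add_assoc, ← hpt p hp, ← hpt q hq, heq]
      rw [← h1] at h3 ⊢
      exact add_left_cancel h3
    have h3 : ‖p - f (x p)‖ + s = ‖q - f (x q)‖ + t := by
      have h4 := congrArg norm h2
      rwa [norm_smul _ (v p), norm_smul _ (v q), hv1 p hp, hv1 q hq, mul_one, mul_one,
        Real.norm_of_nonneg (by positivity), Real.norm_of_nonneg (by positivity)] at h4
    rw [h3] at h2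
    exact smul_right_injective E (by have := hne q hq; positivity) h2

theorem exists_finset_mem_interior_convexHull {E : Type*} [NormedAddCommGroup E]
    [NormedSpace ℝ E] [FiniteDimensional ℝ E] {U : Set E} (hU : IsOpen U) {x : E} (hx : x ∈ U) :
    ∃ s : Finset E, ↑s ⊆ U ∧ x ∈ interior (convexHull ℝ (s : Set E)) := by
  obtain ⟨b, hb, hbU⟩ := exists_mem_interior_convexHull_affineBasis (hU.mem_nhds hx)
  classical
  refine ⟨Finset.univ.image b, ?_, ?_⟩
  · rw [Finset.coe_image, Finset.coe_univ, image_univ]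
    exact (subset_convexHull ℝ _).trans hbU
  · rwa [Finset.coe_image, Finset.coe_univ, image_univ]

/-- Cramer's rule: the area form `Im (conj · * w)` kills the multiple of `w`. -/
theorem sub_eq_smul_of_line_eq {p q v w : ℂ} {s t : ℝ} (h : p + s • v = q + t • w) :
    s * (starRingEnd ℂ v * w).im = (starRingEnd ℂ (q - p) * w).im := by
  have h1 : q - p = s • v - t • w := by
    rw [sub_eq_sub_iff_add_eq_add, ← h]; ring
  rw [h1]
  simp [Complex.mul_im]
  ring

theorem eq_or_eq_neg_of_im_conj_mul_eq_zero {v w : ℂ} (hv : ‖v‖ = 1) (hw : ‖w‖ = 1)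
    (h : (starRingEnd ℂ v * w).im = 0) : v = w ∨ v = -w := by
  have h1 : starRingEnd ℂ v * w = ((starRingEnd ℂ v * w).re : ℂ) := by
    apply Complex.ext <;> simp [h]
  have h2 : |(starRingEnd ℂ v * w).re| = 1 := by
    rw [← Real.norm_eq_abs, ← Complex.norm_real, ← h1]; simp [hv, hw]
  have h3 : v * starRingEnd ℂ v = 1 := by
    rw [Complex.mul_conj, Complex.normSq_eq_norm_sq, hv]; simp
  have h4 : w = v * ((starRingEnd ℂ v * w).re : ℂ) := by
    rw [← h1, ← mul_assoc, h3, one_mul]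
  rcases (abs_eq zero_le_one).1 h2 with h5 | h5
  · left; rw [h4, h5]; simp
  · right; rw [h4, h5]; simp

/-- If `p + s v = q + t w` has a solution with `s, t > 0` for transversal `v, w`, then so does
each nearby equation. -/
theorem eventually_exists_line_eq {α : Type*} {l : Filter α} {p q v w : ℂ} {s t : ℝ}
    (hs : 0 < s) (ht : 0 < t) (h : p + s • v = q + t • w) (hd : (starRingEnd ℂ v * w).im ≠ 0)
    {V W : α → ℂ} (hV : Tendsto V l (𝓝 v)) (hW : Tendsto W l (𝓝 w)) :
    ∀ᶠ a in l, (starRingEnd ℂ (V a) * W a).im ≠ 0 ∧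
      ∃ s' t' : ℝ, 0 < s' ∧ 0 < t' ∧ p + s' • V a = q + t' • W a := by
  have hdl : Tendsto (fun a => (starRingEnd ℂ (V a) * W a).im) l
      (𝓝 (starRingEnd ℂ v * w).im) :=
    Complex.continuous_im.continuousAt.tendsto.comp
      ((Complex.continuous_conj.continuousAt.tendsto.comp hV).mul hW)
  have hsl : Tendsto (fun a => (starRingEnd ℂ (q - p) * W a).im / (starRingEnd ℂ (V a) * W a).im) l
      (𝓝 s) := by
    have h1 : s = (starRingEnd ℂ (q - p) * w).im / (starRingEnd ℂ v * w).im := by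
      rw [eq_div_iff hd, sub_eq_smul_of_line_eq h]
    rw [h1]
    exact (Complex.continuous_im.continuousAt.tendsto.comp (hW.const_mul _)).div hdl hd
  have htl : Tendsto (fun a => (starRingEnd ℂ (q - p) * V a).im / (starRingEnd ℂ (V a) * W a).im) l
      (𝓝 t) := by
    have h1 : t = (starRingEnd ℂ (q - p) * v).im / (starRingEnd ℂ v * w).im := by
      rw [eq_div_iff hd]
      have h2 := sub_eq_smul_of_line_eq h.symm
      have h3 : (starRingEnd ℂ w * v).im = -(starRingEnd ℂ v * w).im := by
        simp [Complex.mul_im]; ring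
      have h4 : (starRingEnd ℂ (p - q) * v).im = -(starRingEnd ℂ (q - p) * v).im := by
        rw [← neg_sub q p]; simp [Complex.mul_im]; ring
      rw [h3, h4] at h2
      linarith
    rw [h1]
    exact (Complex.continuous_im.continuousAt.tendsto.comp (hV.const_mul _)).div hdl hd
  filter_upwards [hdl.eventually_ne hd, hsl.eventually (lt_mem_nhds hs),
    htl.eventually (lt_mem_nhds ht)] with a h1 h2 h3
  refine ⟨h1, _, _, h2, h3, ?_⟩
  have h5 : ((starRingEnd ℂ (V a) * W a).im : ℂ) * (q - p) =
      ((starRingEnd ℂ (q - p) * W a).im : ℂ) * V a -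
        ((starRingEnd ℂ (q - p) * V a).im : ℂ) * W a := by
    apply Complex.ext <;> simp [Complex.mul_im, Complex.mul_re] <;> ring
  have h6 : ((starRingEnd ℂ (V a) * W a).im : ℂ) ≠ 0 := Complex.ofReal_ne_zero.2 h1
  rw [Complex.real_smul, Complex.real_smul, Complex.ofReal_div, Complex.ofReal_div]
  generalize ((starRingEnd ℂ (V a) * W a).im : ℂ) = d at h5 h6 ⊢
  field_simp
  linear_combination -h5

/-- The complement of the image of a convex planar domain under a strictly monotone field is
swept out by rays which do not cross. -/
theorem StrictMonotoneField.exists_rays {f : ℂ → ℂ} {Ω : Set ℂ} (h : StrictMonotoneField f Ω)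
    (hf : ContinuousOn f Ω) (hΩ : IsOpen Ω) (hΩc : Convex ℝ Ω) (hΩn : Ω.Nonempty) :
    ∃ v : ℂ → ℂ, (∀ p ∉ f '' Ω, ‖v p‖ = 1) ∧
      (∀ p ∉ f '' Ω, ∀ s : ℝ, 0 ≤ s → p + s • v p ∉ f '' Ω) ∧
      ∀ p ∉ f '' Ω, ∀ q ∉ f '' Ω, ∀ s t : ℝ, 0 < s → 0 < t →
        p + s • v p = q + t • v q → v p = v q ∨ v p = -v q := by
  classical
  obtain ⟨x₀, hx₀⟩ := hΩn
  -- The hulls of finite subsets form a directed family of compact convex sets whose union is `Ω`;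
  -- the fixed `x₀` keeps them nonempty.
  let ι := {S : Finset ℂ // ↑S ⊆ Ω ∧ x₀ ∈ S}
  let K : ι → Set ℂ := fun S => convexHull ℝ (S.1 : Set ℂ)
  have hKΩ : ∀ S, K S ⊆ Ω := fun S => convexHull_min S.2.1 hΩc
  have hrays := fun S : ι => (h.mono (hKΩ S)).exists_rays_of_isCompact (hf.mono (hKΩ S))
    (S.1.finite_toSet.isCompact_convexHull ℝ) (convex_convexHull ℝ _)
    ⟨x₀, subset_convexHull ℝ _ S.2.2⟩
  choose V hV1 hVray hVcross using hrays
  have hnot : ∀ p ∉ f '' Ω, ∀ S, p ∉ f '' K S := fun p hp S hpS =>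
    hp (image_mono (hKΩ S) hpS)
  have : Nonempty ι := ⟨⟨{x₀}, by simpa using hx₀, by simp⟩⟩
  have : IsDirected ι (· ≤ ·) := ⟨fun S T => ⟨⟨S.1 ∪ T.1, by
    rw [Finset.coe_union]; exact union_subset S.2.1 T.2.1, Finset.mem_union_left _ S.2.2⟩,
    Finset.subset_union_left, Finset.subset_union_right⟩⟩
  -- An ultrafilter makes the unit directions at all points `p` converge simultaneously.
  let l : Ultrafilter ι := Ultrafilter.of atTop
  have hl : (l : Filter ι) ≤ atTop := Ultrafilter.of_le _
  have hlim : ∀ p, ∃ u : ℂ, p ∉ f '' Ω → ‖u‖ = 1 ∧ Tendsto (fun S => V S p) l (𝓝 u) := by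
    intro p
    by_cases hp : p ∈ f '' Ω
    · exact ⟨0, fun h => absurd hp h⟩
    · obtain ⟨u, hu, hu'⟩ := (isCompact_sphere (0 : ℂ) 1).ultrafilter_le_nhds
        (l.map fun S => V S p) (by
          rw [le_principal_iff, Ultrafilter.mem_coe, Ultrafilter.mem_map]
          exact univ_mem' fun S => by simpa using hV1 S p (hnot p hp S))
      exact ⟨u, fun _ => ⟨by simpa using hu, hu'⟩⟩
  choose v hv using hlim
  refine ⟨v, fun p hp => (hv p hp).1, ?_, ?_⟩
  · rintro p hp s hs ⟨y, hy, hyp⟩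
    -- If the limit ray hit the image, it would hit the open image of the interior of one finite
    -- hull. The approximating ray of some larger hull would then enter its own image.
    obtain ⟨S, hS, hyS⟩ := exists_finset_mem_interior_convexHull hΩ hy
    have hsub : interior (convexHull ℝ (S : Set ℂ)) ⊆ Ω :=
      interior_subset.trans (convexHull_min hS hΩc)
    have hnhds : f '' interior (convexHull ℝ (S : Set ℂ)) ∈ 𝓝 (p + s • v p) :=
      ((h.mono hsub).isOpen_image (hf.mono hsub) isOpen_interior).mem_nhds ⟨y, hyS, hyp⟩
    have h1 : Tendsto (fun T => p + s • V T p) l (𝓝 (p + s • v p)) :=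
      ((hv p hp).2.const_smul s).const_add p
    let S' : ι := ⟨insert x₀ S, by
      rw [Finset.coe_insert]; exact insert_subset hx₀ hS, Finset.mem_insert_self _ _⟩
    obtain ⟨T, hT, hST⟩ := ((h1.eventually hnhds).and (hl (eventually_ge_atTop S'))).exists
    refine hVray T p (hnot p hp T) s hs (image_mono ?_ hT)
    refine interior_subset.trans (convexHull_mono ?_)
    have hST' : insert x₀ S ⊆ T.1 := hST
    exact_mod_cast (Finset.subset_insert _ _).trans hST'
  · intro p hp q hq s t hs ht heq
    by_contra hne
    -- A transversal crossing persists under perturbation, but approximating rays that meet are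
    -- parallel. Opposite directions are not excluded in the limit.
    have hd : (starRingEnd ℂ (v p) * v q).im ≠ 0 := fun hd =>
      hne (eq_or_eq_neg_of_im_conj_mul_eq_zero (hv p hp).1 (hv q hq).1 hd)
    obtain ⟨S, hS, s', t', hs', ht', he⟩ :=
      (eventually_exists_line_eq hs ht heq hd (hv p hp).2 (hv q hq).2).exists
    rw [hVcross S p (hnot p hp S) q (hnot q hq S) s' t' hs' ht' he] at hS
    exact hS (by rw [mul_comm, Complex.mul_conj]; simp)

end MonotoneImage

/-! ### Merging non-crossing rays into disjoint half lines. -/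

section CloseToConvex

open scoped InnerProductSpace Topology
open Filter

/-- The orthogonal projection of the origin to the line through `p` with unit direction `u`. -/
noncomputable def lineFoot (u p : ℂ) : ℂ := p - ⟪u, p⟫_ℝ • u

theorem lineFoot_add_smul (u p : ℂ) : lineFoot u p + ⟪u, p⟫_ℝ • u = p := by
  simp [lineFoot]

theorem lineFoot_neg (u p : ℂ) : lineFoot (-u) p = lineFoot u p := by
  rw [lineFoot, inner_neg_left, neg_smul_neg, lineFoot]

theorem lineFoot_foot_add {u : ℂ} (hu : ‖u‖ = 1) (p : ℂ) (s : ℝ) :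
    lineFoot u (lineFoot u p + s • u) = lineFoot u p := by
  have h1 : ⟪u, lineFoot u p + s • u⟫_ℝ = s := by
    simp only [lineFoot, inner_add_right, inner_sub_right, real_inner_smul_right,
      real_inner_self_eq_norm_sq, hu]
    ring
  rw [lineFoot, h1, add_sub_cancel_right]

theorem mem_openHalfLine_iff {a v z : ℂ} :
    z ∈ openHalfLine a v ↔ ∃ s : ℝ, 0 < s ∧ z = a + s • v := by
  simp only [openHalfLine, Complex.real_smul]; rfl

theorem mem_closedHalfLine_iff {a v z : ℂ} :
    z ∈ closedHalfLine a v ↔ ∃ s : ℝ, 0 ≤ s ∧ z = a + s • v := by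
  simp only [closedHalfLine, Complex.real_smul]; rfl

theorem disjoint_openHalfLine_neg {a u : ℂ} (hu : u ≠ 0) :
    Disjoint (openHalfLine a u) (openHalfLine a (-u)) := by
  rw [disjoint_left]
  intro z hz hz'
  obtain ⟨s, hs, rfl⟩ := mem_openHalfLine_iff.1 hz
  obtain ⟨t, ht, h⟩ := mem_openHalfLine_iff.1 hz'
  have h1 : (s + t) • u = 0 := by
    rw [add_right_inj] at h
    rw [add_smul, h]; simp
  rcases smul_eq_zero.1 h1 with h2 | h2
  · linarith
  · exact hu h2

/-- A family of rays in the complement of a planar open set that start at every point of the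
complement and do not cross can be merged to show that the set is close-to-convex. -/
theorem isCloseToConvex_of_rays {Ω : Set ℂ} (hΩ : IsOpen Ω) {v : ℂ → ℂ}
    (hv1 : ∀ p ∉ Ω, ‖v p‖ = 1) (hray : ∀ p ∉ Ω, ∀ s : ℝ, 0 ≤ s → p + s • v p ∉ Ω)
    (hcross : ∀ p ∉ Ω, ∀ q ∉ Ω, ∀ s t : ℝ, 0 < s → 0 < t →
        p + s • v p = q + t • v q → v p = v q ∨ v p = -v q) : IsCloseToConvex Ω := by
  -- A directed line is encoded by its foot `f` and direction `u`. `W` collects the parameters of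
  -- the points whose chosen ray runs along `u`; `Full` says that open rays of direction `±u` cover
  -- the line.
  set W : ℂ → ℂ → Set ℝ := fun f u => {s | f + s • u ∉ Ω ∧ v (f + s • u) = u} with hW
  set Full : ℂ → ℂ → Prop := fun f u => ∀ s : ℝ, ∃ q ∉ Ω, ∃ t : ℝ, 0 < t ∧
    f + s • u = q + t • v q ∧ (v q = u ∨ v q = -u) with hFull
  set f : ℂ → ℂ := fun p => lineFoot (v p) p with hf
  have hWmem : ∀ p ∉ Ω, ⟪v p, p⟫_ℝ ∈ W (f p) (v p) := by
    intro p hp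
    simp only [hW, hf, mem_ofPred_eq, lineFoot_add_smul]
    exact ⟨hp, trivial⟩
  have hFneg : ∀ g u, Full g u → Full g (-u) := by
    intro g u h s
    obtain ⟨q, hq, t, ht, h1, h2⟩ := h (-s)
    refine ⟨q, hq, t, ht, by rw [← h1]; simp, ?_⟩
    rw [neg_neg]; exact h2.symm
  have hWpt : ∀ g u, ∀ s ∈ W g u, ∀ s' > s, ∃ q ∉ Ω, ∃ t : ℝ, 0 < t ∧
      g + s' • u = q + t • v q ∧ v q = u := by
    intro g u s hs s' hss'
    refine ⟨g + s • u, hs.1, s' - s, sub_pos.2 hss', ?_, hs.2⟩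
    rw [hs.2]; module
  have hbdd : ∀ g u, ¬ Full g u → BddBelow (W g u) := by
    intro g u h
    by_contra hb
    refine h fun s => ?_
    obtain ⟨s', hs', hlt⟩ := not_bddBelow_iff.1 hb s
    obtain ⟨q, hq, t, ht, h1, h2⟩ := hWpt g u s' hs' s hlt
    exact ⟨q, hq, t, ht, h1, Or.inl h2⟩
  -- A full line is cut at its foot into two opposite half lines. Otherwise all rays of direction
  -- `u` on the line merge into one half line starting at the infimum of `W`, which is finite by
  -- `hbdd`.
  set R : Set (ℂ × ℂ) := {r | ∃ p ∉ Ω,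
    (Full (f p) (v p) ∧ r.1 = f p ∧ (r.2 = v p ∨ r.2 = -v p)) ∨
    (¬ Full (f p) (v p) ∧ r.1 = f p + sInf (W (f p) (v p)) • v p ∧ r.2 = v p)} with hR
  have hunit : ∀ r ∈ R, ‖r.2‖ = 1 := by
    rintro r ⟨p, hp, ⟨-, -, h | h⟩ | ⟨-, -, h⟩⟩ <;> simp [h, hv1 p hp]
  have hopen : ∀ r ∈ R, ∀ z ∈ openHalfLine r.1 r.2, ∃ q ∉ Ω, ∃ t : ℝ, 0 < t ∧
      z = q + t • v q ∧ (v q = r.2 ∨ v q = -r.2) := by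
    rintro ⟨a, u⟩ ⟨p, hp, ⟨hF, h1, h2⟩ | ⟨hF, h1, h2⟩⟩ z hz
    · obtain ⟨s, hs, rfl⟩ := mem_openHalfLine_iff.1 hz
      dsimp only at h1 h2 ⊢
      have hF' : Full a u := by
        rw [h1]
        rcases h2 with h2 | h2 <;> rw [h2]
        · exact hF
        · exact hFneg _ _ hF
      exact hF' s
    · obtain ⟨s, hs, rfl⟩ := mem_openHalfLine_iff.1 hz
      dsimp only at h1 h2 ⊢
      obtain ⟨s', hs', hlt⟩ := exists_lt_of_csInf_lt ⟨_, hWmem p hp⟩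
        (lt_add_of_pos_right (sInf (W (f p) (v p))) hs)
      obtain ⟨q, hq, t, ht, h3, h4⟩ := hWpt _ _ s' hs' _ hlt
      refine ⟨q, hq, t, ht, ?_, Or.inl (h4.trans h2.symm)⟩
      rw [← h3, h1, h2]; module
  refine ⟨R, fun r hr h0 => by simpa [h0] using hunit r hr, ?_, ?_⟩
  · apply Subset.antisymm
    · intro p hp
      rw [mem_iUnion₂]
      by_cases hF : Full (f p) (v p)
      · rcases le_total 0 ⟪v p, p⟫_ℝ with h | h
        · refine ⟨(f p, v p), ⟨p, hp, Or.inl ⟨hF, rfl, Or.inl rfl⟩⟩,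
            mem_closedHalfLine_iff.2 ⟨_, h, (lineFoot_add_smul _ _).symm⟩⟩
        · refine ⟨(f p, -v p), ⟨p, hp, Or.inl ⟨hF, rfl, Or.inr rfl⟩⟩,
            mem_closedHalfLine_iff.2 ⟨-⟪v p, p⟫_ℝ, neg_nonneg.2 h, ?_⟩⟩
          rw [smul_neg, neg_smul, neg_neg]
          exact (lineFoot_add_smul _ _).symm
      · refine ⟨(f p + sInf (W (f p) (v p)) • v p, v p), ⟨p, hp, Or.inr ⟨hF, rfl, rfl⟩⟩,
          mem_closedHalfLine_iff.2 ⟨⟪v p, p⟫_ℝ - sInf (W (f p) (v p)),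
            sub_nonneg.2 (csInf_le (hbdd _ _ hF) (hWmem p hp)), ?_⟩⟩
        conv_lhs => rw [← lineFoot_add_smul (v p) p]
        simp only [hf]; module
    · refine iUnion₂_subset fun r hr z hz => ?_
      obtain ⟨s, hs, rfl⟩ := mem_closedHalfLine_iff.1 hz
      rcases hs.eq_or_lt with rfl | hs
      · rw [zero_smul, add_zero]
        obtain ⟨p, hp, ⟨hF, h1, -⟩ | ⟨hF, h1, -⟩⟩ := hr
        · obtain ⟨q, hq, t, ht, h3, -⟩ := hF 0
          rw [zero_smul, add_zero] at h3
          rw [h1, h3]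
          exact hray q hq t ht.le
        · have hcl : IsClosed {s : ℝ | f p + s • v p ∈ Ωᶜ} :=
            hΩ.isClosed_compl.preimage (by fun_prop)
          rw [h1]
          exact hcl.closure_subset_iff.2 (fun s hs => hs.1)
            (csInf_mem_closure ⟨_, hWmem p hp⟩ (hbdd _ _ hF))
      · obtain ⟨q, hq, t, ht, h3, -⟩ := hopen r hr _ (mem_openHalfLine_iff.2 ⟨s, hs, rfl⟩)
        rw [h3]
        exact hray q hq t ht.le
  · intro r₁ hr₁ r₂ hr₂ hne
    rw [disjoint_left]
    intro z hz₁ hz₂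
    apply hne
    have hu₁ := hunit r₁ hr₁
    have hdir : r₁.2 = r₂.2 ∨ r₁.2 = -r₂.2 := by
      obtain ⟨q₁, hq₁, t₁, ht₁, h1, h2⟩ := hopen r₁ hr₁ z hz₁
      obtain ⟨q₂, hq₂, t₂, ht₂, h3, h4⟩ := hopen r₂ hr₂ z hz₂
      have h5 := hcross q₁ hq₁ q₂ hq₂ t₁ t₂ ht₁ ht₂ (h1.symm.trans h3)
      rcases h2 with h2 | h2 <;> rcases h4 with h4 | h4 <;> rcases h5 with h5 | h5 <;>
        rw [h2, h4] at h5 <;> try simp only [neg_neg, neg_eq_iff_eq_neg] at h5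
      all_goals tauto
    have hfoot : ∀ r ∈ R, ∀ z ∈ openHalfLine r.1 r.2, ∃ p ∉ Ω, f p = lineFoot r.2 z ∧
        (Full (f p) (v p) ∧ r.1 = f p ∧ (r.2 = v p ∨ r.2 = -v p) ∨
        ¬ Full (f p) (v p) ∧ r.1 = f p + sInf (W (f p) (v p)) • v p ∧ r.2 = v p) := by
      rintro ⟨a, u⟩ ⟨p, hp, h⟩ z hz
      refine ⟨p, hp, ?_, h⟩
      obtain ⟨s, hs, rfl⟩ := mem_openHalfLine_iff.1 hz
      dsimp only at h ⊢
      rcases h with ⟨-, rfl, rfl | rfl⟩ | ⟨-, rfl, rfl⟩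
      · exact (lineFoot_foot_add (hv1 p hp) _ _).symm
      · rw [lineFoot_neg, smul_neg, ← neg_smul]
        exact (lineFoot_foot_add (hv1 p hp) _ _).symm
      · rw [add_assoc, ← add_smul]
        exact (lineFoot_foot_add (hv1 p hp) _ _).symm
    obtain ⟨p₁, hp₁, hf₁, h₁⟩ := hfoot r₁ hr₁ z hz₁
    obtain ⟨p₂, hp₂, hf₂, h₂⟩ := hfoot r₂ hr₂ z hz₂
    have hff : f p₁ = f p₂ := by
      rw [hf₁, hf₂]
      rcases hdir with h | h <;> rw [h]
      rw [lineFoot_neg]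
    rw [hff] at h₁
    have hvv : v p₁ = v p₂ ∨ v p₁ = -v p₂ := by
      have e₁ : r₁.2 = v p₁ ∨ r₁.2 = -v p₁ := by tauto
      have e₂ : r₂.2 = v p₂ ∨ r₂.2 = -v p₂ := by tauto
      rcases e₁ with e₁ | e₁ <;> rcases e₂ with e₂ | e₂ <;> rcases hdir with h5 | h5 <;>
        rw [e₁, e₂] at h5 <;> try simp only [neg_neg, neg_eq_iff_eq_neg] at h5
      all_goals tauto
    have hFF : Full (f p₂) (v p₁) ↔ Full (f p₂) (v p₂) := by
      rcases hvv with h | h <;> rw [h]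
      exact ⟨fun h => by simpa using hFneg _ _ h, hFneg _ _⟩
    rw [hFF] at h₁
    by_cases hF : Full (f p₂) (v p₂)
    · simp only [hF, true_and, not_true, false_and, or_false] at h₁ h₂
      by_contra
      have h3 : r₁.2 = r₂.2 ∨ r₁.2 = -r₂.2 := hdir
      rcases h3 with h3 | h3
      · exact hne (Prod.ext (h₁.1.trans h₂.1.symm) h3)
      · have hd := disjoint_openHalfLine_neg (a := r₂.1) (u := r₂.2)
          (fun h0 => by simpa [h0] using hunit r₂ hr₂)
        rw [h₁.1.trans h₂.1.symm, h3] at hz₁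
        exact disjoint_left.1 hd hz₂ hz₁
    · simp only [hF, false_and, not_false_eq_true, true_and, false_or] at h₁ h₂
      rcases hvv with h | h
      · rw [h] at h₁
        exact Prod.ext (h₁.1.trans h₂.1.symm) (h₁.2.trans h₂.2.symm)
      -- Oppositely directed merged half lines whose interiors meet would cover the whole line,
      -- making it full.
      · exfalso
        apply hF
        obtain ⟨s, hs, hzs⟩ := mem_openHalfLine_iff.1 hz₁
        obtain ⟨t, ht, hzt⟩ := mem_openHalfLine_iff.1 hz₂
        rw [h₁.1, h₁.2, h] at hzs
        rw [h₂.1, h₂.2] at hzt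
        set b₁ := sInf (W (f p₂) (-v p₂))
        set b₂ := sInf (W (f p₂) (v p₂))
        have h3 : (b₁ + s + b₂ + t) • v p₂ = 0 := by
          have := hzs.symm.trans hzt
          rw [← sub_eq_zero] at this
          rw [← neg_eq_zero, ← this]; module
        have h4 : b₁ + s + b₂ + t = 0 := by
          rcases smul_eq_zero.1 h3 with h4 | h4
          · exact h4
          · simpa [h4] using hv1 p₂ hp₂
        intro x
        have hW₁ := hWmem p₁ hp₁
        rw [hff, h] at hW₁
        rcases lt_or_ge b₂ x with hx | hx
        · obtain ⟨s', hs', hlt⟩ := exists_lt_of_csInf_lt ⟨_, hWmem p₂ hp₂⟩ hx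
          obtain ⟨q, hq, t', ht', h5, h6⟩ := hWpt _ _ s' hs' _ hlt
          exact ⟨q, hq, t', ht', h5, Or.inl h6⟩
        · obtain ⟨s', hs', hlt⟩ := exists_lt_of_csInf_lt ⟨_, hW₁⟩ (b := -x)
            (show b₁ < -x by linarith)
          obtain ⟨q, hq, t', ht', h5, h6⟩ := hWpt _ _ s' hs' _ hlt
          exact ⟨q, hq, t', ht', by rw [← h5]; simp, Or.inr h6⟩

/-- The image of a convex planar domain under a continuous strictly monotone field is
close-to-convex. -/
theorem StrictMonotoneField.isCloseToConvex_image {f : ℂ → ℂ} {Ω : Set ℂ}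
    (h : StrictMonotoneField f Ω) (hf : ContinuousOn f Ω) (hΩ : IsOpen Ω) (hΩc : Convex ℝ Ω)
    (hΩn : Ω.Nonempty) : IsCloseToConvex (f '' Ω) := by
  obtain ⟨v, hv1, hray, hcross⟩ := h.exists_rays hf hΩ hΩc hΩn
  exact isCloseToConvex_of_rays (h.isOpen_image hf hΩ) hv1 hray hcross

end CloseToConvex

/-! ### The Poincaré lemma with a countable exceptional set. -/

section Poincare

open scoped unitInterval Topology
open AffineMap Filter

variable {Ω P : Set ℂ} {ω : ℂ → ℂ →L[ℝ] ℂ} {dω : ℂ → ℂ →L[ℝ] ℂ →L[ℝ] ℂ} {a b c : ℂ}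

/-- Injectivity of the triangle's homotopy on the open square makes the preimage of a countable
exceptional set countable. -/
theorem injOn_lineMap_lineMap (h : ¬ ∃ r : ℝ × ℝ, r ≠ 0 ∧ r.1 • (b - a) + r.2 • (c - a) = 0) :
    InjOn (fun x : I × I => lineMap (lineMap a b (x.2 : ℝ)) (lineMap a c (x.2 : ℝ)) (x.1 : ℝ))
      (Ioo 0 1 ×ˢ Ioo 0 1) := by
  rintro ⟨x, y⟩ ⟨-, hy⟩ ⟨x', y'⟩ ⟨-, hy'⟩ heq
  have h1 : ((1 - (x : ℝ)) * y - (1 - x') * y') • (b - a) +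
      ((x : ℝ) * y - x' * y') • (c - a) = 0 := by
    simp only [lineMap_apply_module'] at heq
    rw [← sub_eq_zero] at heq
    rw [← heq]; module
  by_contra hne
  refine h ⟨(_, _), fun h0 => hne ?_, h1⟩
  rw [Prod.mk_eq_zero] at h0
  have hyy : (y : ℝ) = y' := by linarith [h0.1, h0.2]
  have hy0 : (0 : ℝ) < y := hy.1
  have hxx : (x : ℝ) = x' := by
    have := h0.2
    rw [← hyy, ← sub_mul] at this
    rcases mul_eq_zero.1 this with h2 | h2 <;> linarith
  exact Prod.ext (Subtype.ext hxx) (Subtype.ext hyy)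

/-- The integral of a continuous `1`-form that is closed off a countable set along the boundary
of a nondegenerate triangle is zero. -/
theorem curveIntegral_triangle_of_off_countable (hΩ : Convex ℝ Ω) (hP : P.Countable)
    (hω : ContinuousOn ω Ω) (hd : ∀ z ∈ Ω \ P, HasFDerivAt ω (dω z) z)
    (hsymm : ∀ z ∈ Ω \ P, ∀ u v, dω z u v = dω z v u)
    (ha : a ∈ Ω) (hb : b ∈ Ω) (hc : c ∈ Ω)
    (hnd : ¬ ∃ r : ℝ × ℝ, r ≠ 0 ∧ r.1 • (b - a) + r.2 • (c - a) = 0) :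
    (∫ᶜ x in .segment a b, ω x) + ∫ᶜ x in .segment b c, ω x = ∫ᶜ x in .segment a c, ω x := by
  set φ := ContinuousMap.Homotopy.affine (Path.segment a b : C(I, ℂ)) (Path.segment a c)
  have hφ : ∀ x : I × I, φ x = lineMap (lineMap a b (x.2 : ℝ)) (lineMap a c (x.2 : ℝ)) (x.1 : ℝ) :=
    fun x => by simp [φ]
  have hφs : range φ ⊆ Ω := by
    rw [range_subset_iff]
    intro x
    simp [φ, ha, hb, hc, hΩ.lineMap_mem]
  have hcongr : ∀ {x y x' y' : ℂ}, x = x' → y = y' →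
      ∫ᶜ z in .segment x y, ω z = ∫ᶜ z in .segment x' y', ω z := by
    rintro _ _ _ _ rfl rfl; rfl
  have := φ.curveIntegral_add_curveIntegral_eq_of_hasFDerivWithinAt_off_countable (t := range φ)
    (ω := ω) (dω := dω) (s := (Ioo 0 1 ×ˢ Ioo 0 1) ∩ φ ⁻¹' P) ?_ ?_ ?_ ?_ ?_ ?_
  · convert! this using 2
    · dsimp [φ]
      exact hcongr (Path.segment a b).target.symm (Path.segment a c).target.symm
    · dsimp [φ]
      rw [hcongr (Path.segment a b).source (Path.segment a c).source]
      simp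
  · refine MapsTo.countable_of_injOn (f := φ) (fun x hx => hx.2) ?_ hP
    refine InjOn.mono inter_subset_left ?_
    exact (injOn_lineMap_lineMap hnd).congr fun x _ => (hφ x).symm
  · intros
    apply mem_range_self
  · exact fun x hx y hy hxy => (hd _ ⟨hφs (mem_range_self _),
      fun h => hxy ⟨⟨hx, hy⟩, h⟩⟩).hasFDerivWithinAt
  · rw [(isCompact_range <| map_continuous _).isClosed.closure_eq]
    exact hω.mono hφs
  · exact fun x hx y hy hxy u _ v _ => hsymm _ ⟨hφs (mem_range_self _),
      fun h => hxy ⟨⟨hx, hy⟩, h⟩⟩ u v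
  · have : EqOn (fun x : ℝ × ℝ ↦ IccExtend zero_le_one (φ.extend x.1) x.2)
        (fun x ↦ lineMap (lineMap a b x.2) (lineMap a c x.2) x.1) (Icc 0 1) := by
      rw [Icc_prod_eq]
      rintro ⟨x, y⟩ ⟨hx, hy⟩
      lift x to I using hx
      lift y to I using hy
      simp [φ]
    exact .congr (by fun_prop) this

theorem not_collinear_iff_im :
    (¬ ∃ r : ℝ × ℝ, r ≠ 0 ∧ r.1 • (b - a) + r.2 • (c - a) = 0) ↔
      (starRingEnd ℂ (b - a) * (c - a)).im ≠ 0 := by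
  rw [not_iff_comm, not_ne_iff]
  constructor
  · intro h
    by_cases h0 : b - a = 0
    · exact ⟨(1, 0), by simp, by simp [h0]⟩
    · refine ⟨((starRingEnd ℂ (b - a) * (c - a)).re, -Complex.normSq (b - a)), ?_, ?_⟩
      · simp [h0]
      · have h1 : starRingEnd ℂ (b - a) * (c - a) =
            ((starRingEnd ℂ (b - a) * (c - a)).re : ℂ) := by
          apply Complex.ext
          · simp
          · rw [h]; simp
        simp only [Complex.real_smul, Complex.ofReal_neg]
        rw [← h1, ← Complex.mul_conj]; ring
  · rintro ⟨r, hr, h⟩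
    have h1 := congrArg Complex.re h
    have h2 := congrArg Complex.im h
    simp at h1 h2
    simp only [Complex.mul_im, Complex.conj_re, Complex.conj_im, Complex.sub_re, Complex.sub_im]
    by_cases h3 : r.1 = 0
    · have h4 : r.2 ≠ 0 := fun h4 => hr (Prod.ext h3 h4)
      simp only [h3, zero_mul, zero_add, mul_eq_zero, h4, false_or] at h1 h2
      rw [h1, h2]; ring
    · apply mul_left_cancel₀ h3
      linear_combination (c.im - a.im) * h1 - (c.re - a.re) * h2

/-- For collinear points the homotopy is not injective, so `b` is pushed off the line to `b + e`.
The identity follows from the nondegenerate triangles `a, b, b + e`, then `a, b + e, c` and `b, b +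
e, c`. -/
theorem curveIntegral_segment_add_of_off_countable (hΩ : Convex ℝ Ω) (hΩo : IsOpen Ω)
    (hP : P.Countable) (hω : ContinuousOn ω Ω) (hd : ∀ z ∈ Ω \ P, HasFDerivAt ω (dω z) z)
    (hsymm : ∀ z ∈ Ω \ P, ∀ u v, dω z u v = dω z v u)
    (ha : a ∈ Ω) (hb : b ∈ Ω) (hc : c ∈ Ω) :
    (∫ᶜ x in .segment a b, ω x) + ∫ᶜ x in .segment b c, ω x = ∫ᶜ x in .segment a c, ω x := by
  have key : ∀ {a b c : ℂ}, a ∈ Ω → b ∈ Ω → c ∈ Ω →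
      (starRingEnd ℂ (b - a) * (c - a)).im ≠ 0 →
      (∫ᶜ x in .segment a b, ω x) + ∫ᶜ x in .segment b c, ω x = ∫ᶜ x in .segment a c, ω x :=
    fun ha hb hc h => curveIntegral_triangle_of_off_countable hΩ hP hω hd hsymm ha hb hc
      (not_collinear_iff_im.2 h)
  by_cases hnd : (starRingEnd ℂ (b - a) * (c - a)).im = 0
  swap
  · exact key ha hb hc hnd
  rcases eq_or_ne a b with rfl | hab
  · simp
  rcases eq_or_ne b c with rfl | hbc
  · simp
  rcases eq_or_ne a c with rfl | hac
  · rw [← Path.segment_symm a b, curveIntegral_symm]; simp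
  obtain ⟨r, hr, hrΩ⟩ := Metric.isOpen_iff.1 hΩo b hb
  have hba : b - a ≠ 0 := sub_ne_zero.2 hab.symm
  -- A quarter turn of `b - a` scaled to length `r / 2`, so that `b + e` stays in the ball.
  set e : ℂ := ((r / (2 * ‖b - a‖) : ℝ) : ℂ) * (Complex.I * (b - a)) with he
  have hna : 0 < ‖b - a‖ := norm_pos_iff.2 hba
  have heb : b + e ∈ Ω := by
    apply hrΩ
    rw [Metric.mem_ball, dist_eq_norm, add_sub_cancel_left, he, norm_mul, norm_mul,
      Complex.norm_I, one_mul, Complex.norm_real, Real.norm_of_nonneg (by positivity)]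
    field_simp; linarith
  have hρ : 0 < r / (2 * ‖b - a‖) := by positivity
  set ρ := r / (2 * ‖b - a‖)
  have hn : 0 < Complex.normSq (b - a) := Complex.normSq_pos.2 hba
  have h1 : (starRingEnd ℂ (b - a) * (b + e - a)).im = ρ * Complex.normSq (b - a) := by
    simp only [he, Complex.normSq_apply]; simp [Complex.mul_im]; ring
  have h2 : c - a ≠ 0 := sub_ne_zero.2 hac.symm
  have h2' : c - b ≠ 0 := sub_ne_zero.2 hbc.symm
  have hre : ∀ w : ℂ, w ≠ 0 → (starRingEnd ℂ (b - a) * w).im = 0 →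
      (starRingEnd ℂ (b - a) * w).re ≠ 0 := by
    intro w hw h3 h4
    have : starRingEnd ℂ (b - a) * w = 0 := Complex.ext h4 h3
    simp only [mul_eq_zero, map_eq_zero, hba, hw, or_self] at this
  have hcb : (starRingEnd ℂ (b - a) * (c - b)).im = 0 := by
    rw [← hnd]; simp [Complex.mul_im]; ring
  have k1 := key ha hb heb (by rw [h1]; positivity)
  have k2 := key ha heb hc (by
    have : (starRingEnd ℂ (b + e - a) * (c - a)).im =
        (starRingEnd ℂ (b - a) * (c - a)).im - ρ * (starRingEnd ℂ (b - a) * (c - a)).re := by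
      simp only [he]; simp [Complex.mul_im, Complex.mul_re]; ring
    rw [this, hnd, zero_sub]
    exact neg_ne_zero.2 (mul_ne_zero hρ.ne' (hre _ h2 hnd)))
  have k3 := key hb heb hc (by
    have : (starRingEnd ℂ (b + e - b) * (c - b)).im =
        - ρ * (starRingEnd ℂ (b - a) * (c - b)).re := by
      simp only [he]; simp [Complex.mul_im, Complex.mul_re]; ring
    rw [this]
    exact mul_ne_zero (neg_ne_zero.2 hρ.ne') (hre _ h2' hcb))
  rw [← k2, ← k1, ← k3]; ring

/-- The Poincaré lemma for continuous `1`-forms on convex planar domains that are closed off a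
countable set. -/
theorem exists_primitive_of_off_countable (hΩ : Convex ℝ Ω) (hΩo : IsOpen Ω)
    (hP : P.Countable) (hω : ContinuousOn ω Ω) (hd : ∀ z ∈ Ω \ P, HasFDerivAt ω (dω z) z)
    (hsymm : ∀ z ∈ Ω \ P, ∀ u v, dω z u v = dω z v u) :
    ∃ f, ∀ z ∈ Ω, HasFDerivAt f (ω z) z := by
  rcases Ω.eq_empty_or_nonempty with rfl | ⟨a, ha⟩
  · simp
  refine ⟨fun b => ∫ᶜ x in .segment a b, ω x, fun b hb => ?_⟩
  have h1 : HasFDerivWithinAt (fun c => ∫ᶜ x in .segment a b, ω x + ∫ᶜ x in .segment b c, ω x)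
      (ω b) Ω b := .const_add _ (HasFDerivWithinAt.curveIntegral_segment_source hΩ hω hb)
  exact (h1.congr' (fun c hc => (curveIntegral_segment_add_of_off_countable hΩ hΩo hP hω hd hsymm
    ha hb hc).symm) hb).hasFDerivAt (hΩo.mem_nhds hb)

end Poincare

/-! ### Local behaviour of harmonic maps: discreteness of fibres and openness. -/

section HarmonicMap

open scoped Topology
open Filter Asymptotics

/-- The planar map `h - conj k` built from two complex functions. -/
noncomputable def harmonicMap (h k : ℂ → ℂ) (w : ℂ) : ℂ := h w - starRingEnd ℂ (k w)

/-- Holomorphic functions `h, k` on a domain `D` with `h' = p ≢ 0` and `k' = μ p`, where the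
second dilatation `μ` is holomorphic with `|μ| < 1`. -/
structure IsHarmonicPair (D : Set ℂ) (h k p μ : ℂ → ℂ) : Prop where
  isOpen : IsOpen D
  isPreconnected : IsPreconnected D
  hasDerivAt_h : ∀ w ∈ D, HasDerivAt h (p w) w
  hasDerivAt_k : ∀ w ∈ D, HasDerivAt k (μ w * p w) w
  differentiableOn_dilatation : DifferentiableOn ℂ μ D
  norm_dilatation_lt : ∀ w ∈ D, ‖μ w‖ < 1
  exists_ne_zero : ∃ w ∈ D, p w ≠ 0

/-- The real linear map `u ↦ u - σ conj u`. -/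
noncomputable def beltramiMap (σ : ℂ) : ℂ →L[ℝ] ℂ :=
  ContinuousLinearMap.id ℝ ℂ - σ • (Complex.conjCLE : ℂ →L[ℝ] ℂ)

/-- The inverse of `beltramiMap σ` for `|σ| < 1`. -/
noncomputable def beltramiInv (σ : ℂ) : ℂ →L[ℝ] ℂ :=
  (1 - Complex.normSq σ)⁻¹ • (ContinuousLinearMap.id ℝ ℂ + σ • (Complex.conjCLE : ℂ →L[ℝ] ℂ))

theorem beltramiMap_apply (σ u : ℂ) : beltramiMap σ u = u - σ * starRingEnd ℂ u := by
  simp [beltramiMap]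

theorem beltramiInv_apply (σ u : ℂ) :
    beltramiInv σ u = (1 - Complex.normSq σ : ℂ)⁻¹ * (u + σ * starRingEnd ℂ u) := by
  simp [beltramiInv, mul_add]

theorem one_sub_normSq_pos {σ : ℂ} (hσ : ‖σ‖ < 1) : 0 < 1 - Complex.normSq σ := by
  rw [Complex.normSq_eq_norm_sq]
  nlinarith [norm_nonneg σ]

theorem one_sub_normSq_ne_zero {σ : ℂ} (hσ : ‖σ‖ < 1) : (1 - Complex.normSq σ : ℂ) ≠ 0 := by
  exact_mod_cast (one_sub_normSq_pos hσ).ne'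

theorem beltramiInv_beltramiMap {σ : ℂ} (hσ : ‖σ‖ < 1) (u : ℂ) :
    beltramiInv σ (beltramiMap σ u) = u := by
  rw [beltramiInv_apply, beltramiMap_apply, inv_mul_eq_iff_eq_mul₀ (one_sub_normSq_ne_zero hσ),
    ← Complex.mul_conj]
  simp; ring

theorem beltramiMap_beltramiInv {σ : ℂ} (hσ : ‖σ‖ < 1) (u : ℂ) :
    beltramiMap σ (beltramiInv σ u) = u := by
  have h0 := one_sub_normSq_ne_zero hσ
  rw [beltramiInv_apply, beltramiMap_apply]
  simp only [map_mul, map_add, map_inv₀, map_sub, map_one, Complex.conj_ofReal, Complex.conj_conj]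
  field_simp
  rw [← Complex.mul_conj]; ring

/-- The equivalence `u ↦ u - σ conj u` for `|σ| < 1`. -/
noncomputable def beltramiEquiv (σ : ℂ) (hσ : ‖σ‖ < 1) : ℂ ≃L[ℝ] ℂ :=
  ContinuousLinearEquiv.equivOfInverse (beltramiMap σ) (beltramiInv σ)
    (beltramiInv_beltramiMap hσ) (beltramiMap_beltramiInv hσ)

theorem continuousAt_beltramiInv {σ : ℂ} (hσ : ‖σ‖ < 1) : ContinuousAt beltramiInv σ := by
  unfold beltramiInv
  have h1 : ContinuousAt (fun σ : ℂ => (1 - Complex.normSq σ)⁻¹) σ :=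
    (continuous_const.sub Complex.continuous_normSq).continuousAt.inv₀ (one_sub_normSq_pos hσ).ne'
  have h2 : ContinuousAt (fun σ : ℂ => ContinuousLinearMap.id ℝ ℂ +
      σ • (Complex.conjCLE : ℂ →L[ℝ] ℂ)) σ := by fun_prop
  exact h1.smul h2

namespace IsHarmonicPair

variable {D : Set ℂ} {h k p μ : ℂ → ℂ}

theorem differentiableOn_h (H : IsHarmonicPair D h k p μ) : DifferentiableOn ℂ h D :=
  fun w hw => (H.hasDerivAt_h w hw).differentiableAt.differentiableWithinAt

theorem differentiableOn_k (H : IsHarmonicPair D h k p μ) : DifferentiableOn ℂ k D :=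
  fun w hw => (H.hasDerivAt_k w hw).differentiableAt.differentiableWithinAt

theorem analyticOnNhd_p (H : IsHarmonicPair D h k p μ) : AnalyticOnNhd ℂ p D := by
  have h1 := (H.differentiableOn_h.analyticOnNhd H.isOpen).deriv
  exact h1.congr H.isOpen fun w hw => (H.hasDerivAt_h w hw).deriv

theorem not_eventually_p_eq_zero (H : IsHarmonicPair D h k p μ) {w : ℂ} (hw : w ∈ D) :
    ¬ ∀ᶠ z in 𝓝 w, p z = 0 := by
  intro h0
  obtain ⟨z, hz, hpz⟩ := H.exists_ne_zero
  exact hpz (H.analyticOnNhd_p.eqOn_zero_of_preconnected_of_eventuallyEq_zero H.isPreconnected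
    hw h0 hz)

theorem countable_zeros (H : IsHarmonicPair D h k p μ) : {w ∈ D | p w = 0}.Countable := by
  refine (HereditarilyLindelofSpace.isLindelof _).countable_of_isDiscrete
    (isDiscrete_iff_nhdsNE.2 fun w hw => ?_)
  have h1 := ((H.analyticOnNhd_p w hw.1).eventually_eq_zero_or_eventually_ne_zero).resolve_left
    (H.not_eventually_p_eq_zero hw.1)
  rw [← disjoint_iff, disjoint_principal_right]
  filter_upwards [h1] with z hz hz' using hz hz'.2

/-- Near each point the increment of `k` is asymptotically the multiple `μ w₀` of the increment
of `h`, also at the zeros of `h'`. -/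
theorem isLittleO (H : IsHarmonicPair D h k p μ) {w₀ : ℂ} (hw₀ : w₀ ∈ D) :
    (fun w => k w - k w₀ - μ w₀ * (h w - h w₀)) =o[𝓝 w₀] fun w => h w - h w₀ := by
  have hD := H.isOpen.mem_nhds hw₀
  have hh : AnalyticAt ℂ h w₀ := H.differentiableOn_h.analyticAt hD
  have hk : AnalyticAt ℂ k w₀ := H.differentiableOn_k.analyticAt hD
  have hμ : AnalyticAt ℂ μ w₀ := H.differentiableOn_dilatation.analyticAt hD
  have hp : AnalyticAt ℂ p w₀ := H.analyticOnNhd_p w₀ hw₀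
  -- Here `e' = (μ - μ w₀) p` vanishes to higher order than `p = h'`. If `p` has order `n`, the
  -- increment of `h` has order `n + 1` and that of `e` at least `n + 2`.
  set e : ℂ → ℂ := fun w => k w - μ w₀ * h w with he
  have hea : AnalyticAt ℂ e w₀ := by fun_prop
  have hderiv_e : deriv e =ᶠ[𝓝 w₀] (fun w => μ w - μ w₀) * p := by
    filter_upwards [hD] with w hw
    have := ((H.hasDerivAt_k w hw).sub ((H.hasDerivAt_h w hw).const_mul (μ w₀))).deriv
    rw [he]
    refine Eq.trans this ?_
    simp only [Pi.mul_apply]; ring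
  have hderiv_h : deriv h =ᶠ[𝓝 w₀] p := by
    filter_upwards [hD] with w hw using (H.hasDerivAt_h w hw).deriv
  obtain ⟨n, hn⟩ : ∃ n : ℕ, analyticOrderAt p w₀ = n := by
    have : analyticOrderAt p w₀ ≠ ⊤ := fun h0 =>
      H.not_eventually_p_eq_zero hw₀ (analyticOrderAt_eq_top.1 h0)
    exact ⟨_, (ENat.natCast_toNat this).symm⟩
  have hordh : analyticOrderAt (fun w => h w - h w₀) w₀ = ((n + 1 : ℕ) : ℕ∞) := by
    rw [← hh.analyticOrderAt_deriv_add_one, analyticOrderAt_congr hderiv_h, hn]; rfl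
  have horde : ((n + 2 : ℕ) : ℕ∞) ≤ analyticOrderAt (fun w => e w - e w₀) w₀ := by
    rw [← hea.analyticOrderAt_deriv_add_one, analyticOrderAt_congr hderiv_e,
      analyticOrderAt_mul (by fun_prop) hp, hn]
    have h1 : 1 ≤ analyticOrderAt (fun w => μ w - μ w₀) w₀ := by
      rw [Order.one_le_iff_pos, pos_iff_ne_zero, Ne, AnalyticAt.analyticOrderAt_eq_zero
        (by fun_prop)]
      simp
    calc ((n + 2 : ℕ) : ℕ∞) = 1 + n + 1 := by push_cast; ring
      _ ≤ _ := by gcongr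
  obtain ⟨U, hU, hU0, hUeq⟩ := (AnalyticAt.analyticOrderAt_eq_natCast (by fun_prop)).1 hordh
  obtain ⟨V, hV, hVeq⟩ := (natCast_le_analyticOrderAt (by fun_prop)).1 horde
  have h1 : (fun w => k w - k w₀ - μ w₀ * (h w - h w₀)) =O[𝓝 w₀] fun w => (w - w₀) ^ (n + 2) := by
    have h2 : (fun w => (w - w₀) ^ (n + 2) * V w) =O[𝓝 w₀] fun w => (w - w₀) ^ (n + 2) * 1 :=
      (isBigO_refl _ _).mul (hV.continuousAt.tendsto.isBigO_one ℂ)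
    simp only [mul_one] at h2
    refine h2.congr' ?_ EventuallyEq.rfl
    filter_upwards [hVeq] with w hw
    rw [← smul_eq_mul, ← hw, he]; ring
  have h2 : (fun w => (w - w₀) ^ (n + 1)) =O[𝓝 w₀] fun w => h w - h w₀ := by
    have h3 : (fun w => (w - w₀) ^ (n + 1) * U w * (U w)⁻¹) =O[𝓝 w₀]
        fun w => (w - w₀) ^ (n + 1) * U w * 1 :=
      (isBigO_refl _ _).mul ((hU.continuousAt.inv₀ hU0).tendsto.isBigO_one ℂ)
    refine h3.congr' ?_ ?_
    · filter_upwards [hU.continuousAt.eventually_ne hU0] with w hw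
      rw [mul_inv_cancel_right₀ hw]
    · filter_upwards [hUeq] with w hw
      rw [hw, smul_eq_mul, mul_one]
  have h3 : (fun w => (w - w₀) ^ (n + 2)) =o[𝓝 w₀] fun w => (w - w₀) ^ (n + 1) := by
    have h4 : (fun w => (w - w₀) * (w - w₀) ^ (n + 1)) =o[𝓝 w₀]
        fun w => 1 * (w - w₀) ^ (n + 1) := by
      refine IsLittleO.mul_isBigO ?_ (isBigO_refl _ _)
      rw [isLittleO_one_iff]
      have : ContinuousAt (fun w => w - w₀) w₀ := by fun_prop
      simpa [ContinuousAt] using this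
    simpa [pow_succ'] using h4
  exact (h1.trans_isLittleO h3).trans_isBigO h2

theorem not_eventually_h_eq (H : IsHarmonicPair D h k p μ) {w₀ : ℂ} (hw₀ : w₀ ∈ D) :
    ¬ ∀ᶠ w in 𝓝 w₀, h w = h w₀ := by
  intro h0
  apply H.not_eventually_p_eq_zero hw₀
  have h1 : deriv h =ᶠ[𝓝 w₀] deriv fun _ => h w₀ := EventuallyEq.deriv h0
  filter_upwards [h1, H.isOpen.mem_nhds hw₀] with w hw hwD
  rw [← (H.hasDerivAt_h w hwD).deriv, hw, deriv_const]

theorem harmonicMap_sub (w w₀ : ℂ) : harmonicMap h k w - harmonicMap h k w₀ =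
    beltramiMap (starRingEnd ℂ (μ w₀)) (h w - h w₀) -
      starRingEnd ℂ (k w - k w₀ - μ w₀ * (h w - h w₀)) := by
  simp only [harmonicMap, beltramiMap_apply, map_sub, map_mul]; ring

/-- A harmonic map moves in every direction near every point. -/
theorem exists_approx_direction (H : IsHarmonicPair D h k p μ) {w₀ : ℂ} (hw₀ : w₀ ∈ D) {N : Set ℂ}
    (hN : N ∈ 𝓝 w₀) {d : ℂ} (hd : d ≠ 0) : ∃ w ∈ N, ∃ τ : ℝ, 0 < τ ∧ τ ≤ 1 ∧
      ‖harmonicMap h k w - harmonicMap h k w₀ - τ • d‖ ≤ τ * ‖d‖ / 2 := by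
  have hσ : ‖starRingEnd ℂ (μ w₀)‖ < 1 := by
    rw [RCLike.norm_conj]; exact H.norm_dilatation_lt w₀ hw₀
  set σ := starRingEnd ℂ (μ w₀) with hσdef
  -- The linear part of `f` sends `ξ` to `d`. Since `h` is open, its increment can be made exactly
  -- `τ ξ`, even at a zero of `h'`.
  set ξ := beltramiInv σ d with hξ
  have hd0 : 0 < ‖d‖ := norm_pos_iff.2 hd
  have hbd : beltramiMap σ ξ = d := beltramiMap_beltramiInv hσ d
  have hξ0 : 0 < ‖ξ‖ := norm_pos_iff.2 fun h0 => hd (by rw [← hbd, h0, map_zero])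
  have hN' := (H.isLittleO hw₀).bound (c := ‖d‖ / (2 * ‖ξ‖)) (by positivity)
  have hopen : 𝓝 (h w₀) ≤ map h (𝓝 w₀) :=
    (H.differentiableOn_h.analyticAt
      (H.isOpen.mem_nhds hw₀)).eventually_constant_or_nhds_le_map_nhds.resolve_left
      (H.not_eventually_h_eq hw₀)
  have himg := hopen (image_mem_map (inter_mem hN hN'))
  have hlim : Tendsto (fun τ : ℝ => h w₀ + τ • ξ) (𝓝[>] 0) (𝓝 (h w₀)) := by
    have : Continuous fun τ : ℝ => h w₀ + τ • ξ := by fun_prop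
    simpa using (this.tendsto 0).mono_left (nhdsWithin_le_nhds (s := Ioi 0))
  obtain ⟨τ, ⟨w, ⟨hwN, hwN'⟩, hw⟩, hτ0, hτ1⟩ :=
    ((hlim.eventually himg).and (Ioc_mem_nhdsGT (zero_lt_one' ℝ))).exists
  refine ⟨w, hwN, τ, hτ0, hτ1, ?_⟩
  have h1 : h w - h w₀ = τ • ξ := by rw [hw]; ring
  rw [harmonicMap_sub (μ := μ), h1, ← hσdef, map_smul, hbd, sub_sub_cancel_left, norm_neg,
    RCLike.norm_conj, ← h1]
  refine hwN'.trans (le_of_eq ?_)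
  rw [h1, norm_smul, Real.norm_of_nonneg hτ0.le]
  field_simp

theorem continuousOn_harmonicMap (H : IsHarmonicPair D h k p μ) :
    ContinuousOn (harmonicMap h k) D :=
  H.differentiableOn_h.continuousOn.sub
    (Complex.continuous_conj.comp_continuousOn H.differentiableOn_k.continuousOn)

/-- The Beltrami part of the increment has size at least `(1 - |μ w₀|) ‖h w - h w₀‖`, and near `w₀`
the error is at most half of this. -/
theorem eventually_harmonicMap_ne (H : IsHarmonicPair D h k p μ) {w₀ : ℂ} (hw₀ : w₀ ∈ D) :
    ∀ᶠ w in 𝓝[≠] w₀, harmonicMap h k w ≠ harmonicMap h k w₀ := by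
  have hμ := H.norm_dilatation_lt w₀ hw₀
  have hN := (H.isLittleO hw₀).bound (c := (1 - ‖μ w₀‖) / 2) (by linarith)
  have hh : AnalyticAt ℂ (fun w => h w - h w₀) w₀ :=
    (H.differentiableOn_h.analyticAt (H.isOpen.mem_nhds hw₀)).sub analyticAt_const
  have hne := hh.eventually_eq_zero_or_eventually_ne_zero.resolve_left fun h0 =>
    H.not_eventually_h_eq hw₀ (h0.mono fun w hw => sub_eq_zero.1 hw)
  filter_upwards [hne, nhdsWithin_le_nhds hN] with w hw hwN heq
  have h1 := harmonicMap_sub (h := h) (k := k) (μ := μ) w w₀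
  rw [heq, sub_self, eq_comm, sub_eq_zero, beltramiMap_apply, sub_eq_iff_eq_add] at h1
  have h2 : ‖h w - h w₀‖ ≤ (1 - ‖μ w₀‖) / 2 * ‖h w - h w₀‖ + ‖μ w₀‖ * ‖h w - h w₀‖ := by
    conv_lhs => rw [h1]
    refine (norm_add_le _ _).trans ?_
    rw [RCLike.norm_conj, norm_mul, RCLike.norm_conj, RCLike.norm_conj]
    gcongr
  have h3 : 0 < ‖h w - h w₀‖ := norm_pos_iff.2 hw
  nlinarith

/-- Harmonic maps with dilatation less than one are open. -/
theorem image_mem_nhds (H : IsHarmonicPair D h k p μ) {w₀ : ℂ} (hw₀ : w₀ ∈ D) {N : Set ℂ}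
    (hN : N ∈ 𝓝 w₀) : harmonicMap h k '' N ∈ 𝓝 (harmonicMap h k w₀) := by
  set f := harmonicMap h k
  have hne : ∀ᶠ w in 𝓝 w₀, w ≠ w₀ → f w ≠ f w₀ :=
    eventually_nhdsWithin_iff.1 (H.eventually_harmonicMap_ne hw₀)
  obtain ⟨r, hr, hrN⟩ := Metric.nhds_basis_closedBall.mem_iff.1
    (inter_mem (inter_mem hN (H.isOpen.mem_nhds hw₀)) hne)
  have hrD : Metric.closedBall w₀ r ⊆ D := fun w hw => (hrN hw).1.2
  have hcont : ContinuousOn f (Metric.closedBall w₀ r) := H.continuousOn_harmonicMap.mono hrD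
  obtain ⟨m, hm, hmS⟩ : ∃ m > 0, ∀ w ∈ Metric.sphere w₀ r, m ≤ ‖f w - f w₀‖ := by
    obtain ⟨y, hy, hmin⟩ := (isCompact_sphere w₀ r).exists_isMinOn
      (NormedSpace.sphere_nonempty.2 hr.le) (f := fun w => ‖f w - f w₀‖)
      ((hcont.mono Metric.sphere_subset_closedBall).sub continuousOn_const).norm
    exact ⟨_, norm_pos_iff.2 (sub_ne_zero.2 ((hrN (Metric.sphere_subset_closedBall hy)).2
      (Metric.ne_of_mem_sphere hy hr.ne'))), fun z hz => hmin hz⟩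
  -- Minimise the distance from `f w` to `y` over the ball. The radius `m / 2` keeps minimisers off
  -- the sphere, and at an interior minimiser with `f w ≠ y` a move in the approximate direction `y
  -- - f w` would reduce the distance.
  refine Metric.mem_nhds_iff.2 ⟨m / 2, by positivity, fun y hy => ?_⟩
  rw [Metric.mem_ball, dist_comm, dist_eq_norm] at hy
  obtain ⟨w, hw, hmin⟩ := (isCompact_closedBall w₀ r).exists_isMinOn
    (Metric.nonempty_closedBall.2 hr.le) (f := fun w => ‖f w - y‖)
    (hcont.sub continuousOn_const).norm
  have hw0 : ‖f w - y‖ ≤ ‖f w₀ - y‖ := hmin (Metric.mem_closedBall_self hr.le)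
  have hwr : w ∈ Metric.ball w₀ r := by
    refine lt_of_le_of_ne (Metric.mem_closedBall.1 hw) fun heq => ?_
    have h1 := hmS w heq
    have h2 : ‖f w - f w₀‖ ≤ ‖f w - y‖ + ‖f w₀ - y‖ := by
      rw [norm_sub_rev (f w₀)]
      exact norm_sub_le_norm_sub_add_norm_sub _ _ _
    linarith
  refine ⟨w, (hrN hw).1.1, ?_⟩
  by_contra hfw
  have hd : y - f w ≠ 0 := sub_ne_zero.2 (Ne.symm hfw)
  obtain ⟨w', hw', τ, hτ0, hτ1, hle⟩ := H.exists_approx_direction (hrD hw)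
    (Metric.isOpen_ball.mem_nhds hwr) hd
  have h1 : ‖f w - y‖ ≤ ‖f w' - y‖ := hmin (Metric.ball_subset_closedBall hw')
  have h2 : f w' - y = (f w' - f w - τ • (y - f w)) - (1 - τ) • (y - f w) := by module
  have h3 : ‖f w' - y‖ ≤ τ * ‖y - f w‖ / 2 + (1 - τ) * ‖y - f w‖ := by
    rw [h2]
    refine (norm_sub_le _ _).trans ?_
    rw [norm_smul, Real.norm_of_nonneg (sub_nonneg.2 hτ1)]
    gcongr
  rw [norm_sub_rev] at h1
  have h4 : 0 < ‖y - f w‖ := norm_pos_iff.2 hd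
  nlinarith

theorem isOpen_image (H : IsHarmonicPair D h k p μ) : IsOpen (harmonicMap h k '' D) := by
  rw [isOpen_iff_mem_nhds]
  rintro _ ⟨w, hw, rfl⟩
  exact H.image_mem_nhds hw (H.isOpen.mem_nhds hw)

end IsHarmonicPair

end HarmonicMap

/-! ### Factoring the holomorphic data through the harmonic projection. -/

section Factorization

open scoped Topology
open Filter

/-- A quadratic equation determining the Gauss map from the gradient of a graph has at most one
admissible solution. -/
theorem gauss_eq_of_gradient_eq {Q g₁ g₂ : ℂ} {t l : ℝ} (hl : l ≠ 0) (h₁ : ‖t * g₁ ^ 2‖ < 1)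
    (h₂ : ‖t * g₂ ^ 2‖ < 1) (e₁ : Q - starRingEnd ℂ Q * (t * g₁ ^ 2) = 2 * l * g₁)
    (e₂ : Q - starRingEnd ℂ Q * (t * g₂ ^ 2) = 2 * l * g₂) : g₁ = g₂ := by
  by_contra hne
  have hl' : (l : ℂ) ≠ 0 := Complex.ofReal_ne_zero.2 hl
  -- Subtract the equations and divide by `g₁ - g₂`. Eliminating `l` gives `|Q| = |Q| |t g₁ g₂|`,
  -- hence `Q = 0`, and then `l = 0`.
  have h3 : 2 * l + starRingEnd ℂ Q * t * (g₁ + g₂) = 0 := by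
    apply mul_left_cancel₀ (sub_ne_zero.2 hne)
    linear_combination e₂ - e₁
  have h4 : Q = -(starRingEnd ℂ Q * (t * (g₁ * g₂))) := by
    linear_combination e₁ + g₁ * h3
  have h5 : ‖t * (g₁ * g₂)‖ < 1 := by
    have : ‖t * (g₁ * g₂)‖ ^ 2 < 1 ^ 2 := by
      calc ‖t * (g₁ * g₂)‖ ^ 2 = ‖t * g₁ ^ 2‖ * ‖t * g₂ ^ 2‖ := by
            simp only [norm_mul, norm_pow]; ring
        _ < 1 * 1 := mul_lt_mul'' h₁ h₂ (norm_nonneg _) (norm_nonneg _)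
        _ = 1 ^ 2 := by norm_num
    exact lt_of_pow_lt_pow_left₀ 2 zero_le_one this
  have h6 : ‖Q‖ = ‖Q‖ * ‖t * (g₁ * g₂)‖ := by
    conv_lhs => rw [h4]
    rw [norm_neg, norm_mul, RCLike.norm_conj]
  have h7 : Q = 0 := by
    by_contra h0
    have := norm_pos_iff.2 h0
    nlinarith
  rw [h7] at h3
  simp [hl'] at h3

namespace IsHarmonicPair

variable {D : Set ℂ} {h k p μ : ℂ → ℂ}

theorem norm_conj_dilatation_lt (H : IsHarmonicPair D h k p μ) {w : ℂ} (hw : w ∈ D) :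
    ‖starRingEnd ℂ (μ w)‖ < 1 := by
  rw [RCLike.norm_conj]; exact H.norm_dilatation_lt w hw

theorem hasFDerivAt (H : IsHarmonicPair D h k p μ) {w : ℂ} (hw : w ∈ D) :
    HasFDerivAt (harmonicMap h k)
      ((beltramiMap (starRingEnd ℂ (μ w))).comp (p w • (1 : ℂ →L[ℝ] ℂ))) w := by
  have h1 := (H.hasDerivAt_h w hw).complexToReal_fderiv
  have h2 := (H.hasDerivAt_k w hw).complexToReal_fderiv
  have h3 := h1.sub ((Complex.conjCLE : ℂ →L[ℝ] ℂ).hasFDerivAt.comp w h2)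
  refine h3.congr_fderiv ?_
  ext
  simp [beltramiMap_apply, mul_assoc]

theorem contDiffAt_of_differentiableOn {D : Set ℂ} (hD : IsOpen D) {K : ℂ → ℂ}
    (hK : DifferentiableOn ℂ K D) {w : ℂ} (hw : w ∈ D) : ContDiffAt ℝ 2 K w :=
  (hK.analyticAt (hD.mem_nhds hw)).contDiffAt.restrict_scalars ℝ

theorem contDiffAt (H : IsHarmonicPair D h k p μ) {w : ℂ} (hw : w ∈ D) :
    ContDiffAt ℝ 2 (harmonicMap h k) w :=
  (contDiffAt_of_differentiableOn H.isOpen H.differentiableOn_h hw).sub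
    (Complex.conjCLE.contDiff.contDiffAt.comp w
      (contDiffAt_of_differentiableOn H.isOpen H.differentiableOn_k hw))

/-- Harmonic maps have smooth local inverses at points where `h' ≠ 0`. -/
theorem exists_local_section (H : IsHarmonicPair D h k p μ) {w : ℂ} (hw : w ∈ D) (hp : p w ≠ 0) :
    ∃ ψ : ℂ → ℂ, ψ (harmonicMap h k w) = w ∧ ContDiffAt ℝ 2 ψ (harmonicMap h k w) ∧
      ∀ᶠ y in 𝓝 (harmonicMap h k w), harmonicMap h k (ψ y) = y := by
  let e : ℂ ≃L[ℝ] ℂ := ContinuousLinearEquiv.equivOfInverse (p w • (1 : ℂ →L[ℝ] ℂ))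
    ((p w)⁻¹ • (1 : ℂ →L[ℝ] ℂ)) (fun u => by simp [hp]) (fun u => by simp [hp])
  have h1 : HasFDerivAt (harmonicMap h k)
      ((e.trans (beltramiEquiv _ (H.norm_conj_dilatation_lt hw)) : ℂ ≃L[ℝ] ℂ) : ℂ →L[ℝ] ℂ) w :=
    H.hasFDerivAt hw
  have h2 := H.contDiffAt hw
  refine ⟨h2.localInverse h1 two_ne_zero, h2.localInverse_apply_image h1 two_ne_zero,
    h2.to_localInverse h1 two_ne_zero, ?_⟩
  exact (h2.hasStrictFDerivAt' h1 two_ne_zero).eventually_right_inverse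

/-- Differentiating `f ∘ ψ = id` identifies `p Dψ` with the inverse Beltrami map. The factor `p`
thus disappears from the derivative of `K ∘ ψ`, and the resulting form remains meaningful at
critical values. -/
theorem hasFDerivAt_comp_section (H : IsHarmonicPair D h k p μ) {K C ψ : ℂ → ℂ}
    (hK : ∀ w ∈ D, HasDerivAt K (C w * p w) w) {y : ℂ} (hψ : DifferentiableAt ℝ ψ y)
    (hyD : ψ y ∈ D) (hinv : ∀ᶠ x in 𝓝 y, harmonicMap h k (ψ x) = x) :
    HasFDerivAt (fun x => K (ψ x)) (C (ψ y) • beltramiInv (starRingEnd ℂ (μ (ψ y)))) y := by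
  have h1 := (H.hasFDerivAt hyD).comp y hψ.hasFDerivAt
  have h2 : HasFDerivAt (fun x : ℂ => x) _ y := h1.congr_of_eventuallyEq
    (hinv.mono fun x hx => hx.symm)
  have h3 := h2.unique (hasFDerivAt_id y)
  have h4 := (hK _ hyD).complexToReal_fderiv.comp y hψ.hasFDerivAt
  refine h4.congr_fderiv (ContinuousLinearMap.ext fun u => ?_)
  have h5 : beltramiMap (starRingEnd ℂ (μ (ψ y))) (p (ψ y) * fderiv ℝ ψ y u) = u := by
    simpa using congrArg (fun L : ℂ →L[ℝ] ℂ => L u) h3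
  have h6 : beltramiInv (starRingEnd ℂ (μ (ψ y))) u = p (ψ y) * fderiv ℝ ψ y u := by
    conv_lhs => rw [← h5]
    exact beltramiInv_beltramiMap (H.norm_conj_dilatation_lt hyD) _
  simp [h6, mul_assoc]

/-- A continuous function on the domain that is constant on the fibres of a harmonic map descends
to a continuous function on the image. -/
theorem exists_continuousOn_descent (H : IsHarmonicPair D h k p μ) {G : ℂ → ℂ}
    (hG : ContinuousOn G D)
    (hfib : ∀ w₁ ∈ D, ∀ w₂ ∈ D, harmonicMap h k w₁ = harmonicMap h k w₂ → G w₁ = G w₂) :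
    ∃ g : ℂ → ℂ, ContinuousOn g (harmonicMap h k '' D) ∧
      ∀ w ∈ D, g (harmonicMap h k w) = G w := by
  have hg : ∀ w ∈ D, (G ∘ Function.invFunOn (harmonicMap h k) D) (harmonicMap h k w) = G w :=
    fun w hw => hfib _ (Function.invFunOn_mem ⟨w, hw, rfl⟩) _ hw
      (Function.invFunOn_eq (f := harmonicMap h k) ⟨w, hw, rfl⟩)
  refine ⟨_, ?_, hg⟩
  rintro _ ⟨w, hw, rfl⟩
  refine ContinuousAt.continuousWithinAt fun V hV => ?_
  rw [hg w hw] at hV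
  have hN : D ∩ G ⁻¹' V ∈ 𝓝 w :=
    inter_mem (H.isOpen.mem_nhds hw) ((hG.continuousAt (H.isOpen.mem_nhds hw)) hV)
  rw [mem_map]
  refine mem_of_superset (H.image_mem_nhds hw hN) ?_
  rintro _ ⟨w', ⟨hw'D, hw'V⟩, rfl⟩
  rw [mem_preimage, hg w' hw'D]
  exact hw'V

/-- A function constant on the fibres away from the zeros of `h'` is constant on all fibres. -/
theorem eq_of_harmonicMap_eq (H : IsHarmonicPair D h k p μ) {G : ℂ → ℂ} (hG : ContinuousOn G D)
    (hfib : ∀ w₁ ∈ D, ∀ w₂ ∈ D, p w₁ ≠ 0 → p w₂ ≠ 0 →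
      harmonicMap h k w₁ = harmonicMap h k w₂ → G w₁ = G w₂) :
    ∀ w₁ ∈ D, ∀ w₂ ∈ D, harmonicMap h k w₁ = harmonicMap h k w₂ → G w₁ = G w₂ := by
  intro w₁ hw₁ w₂ hw₂ heq
  by_contra hne
  obtain ⟨U₁, U₂, hU₁, hU₂, hdisj⟩ := t2_separation_nhds hne
  have hN : ∀ w ∈ D, ∀ U ∈ 𝓝 (G w), D ∩ G ⁻¹' U ∈ 𝓝 w := fun w hw U hU =>
    inter_mem (H.isOpen.mem_nhds hw) ((hG.continuousAt (H.isOpen.mem_nhds hw)) hU)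
  have hI := inter_mem (heq ▸ H.image_mem_nhds hw₁ (hN w₁ hw₁ U₁ hU₁))
    (H.image_mem_nhds hw₂ (hN w₂ hw₂ U₂ hU₂))
  -- Critical values are countable, so some regular value is attained near both `w₁` and `w₂`, where
  -- `G` would take values in disjoint sets.
  have hdense := (H.countable_zeros.image (harmonicMap h k)).dense_compl ℝ
  obtain ⟨y, hy, ⟨a₁, ⟨ha₁, hG₁⟩, rfl⟩, a₂, ⟨ha₂, hG₂⟩, hf⟩ := hdense.inter_nhds_nonempty hI
  have hp : ∀ a ∈ D, harmonicMap h k a = harmonicMap h k a₁ → p a ≠ 0 := fun a ha he h0 =>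
    hy ⟨a, ⟨ha, h0⟩, he⟩
  have := hfib a₁ ha₁ a₂ ha₂ (hp a₁ ha₁ rfl) (hp a₂ ha₂ hf) hf.symm
  exact disjoint_left.1 hdisj hG₁ (this ▸ hG₂ : G a₁ ∈ U₂)

/-- If the harmonic map is the projection of a graph, then the Gauss map is constant on its
fibres. -/
theorem gauss_eq_of_graph (H : IsHarmonicPair D h k p μ) {T G : ℂ → ℂ} {t l : ℝ} (hl : l ≠ 0)
    (hT : ∀ w ∈ D, HasDerivAt T (2 * l * G w * p w) w) (hμ : ∀ w ∈ D, μ w = t * G w ^ 2)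
    {φ : ℂ → ℝ} (hφ : ∀ w ∈ D, (T w).re = φ (harmonicMap h k w)) {w₁ w₂ : ℂ} (hw₁ : w₁ ∈ D)
    (hw₂ : w₂ ∈ D) (hp₁ : p w₁ ≠ 0) (hp₂ : p w₂ ≠ 0)
    (heq : harmonicMap h k w₁ = harmonicMap h k w₂) : G w₁ = G w₂ := by
  obtain ⟨ψ, hψ, hψc, hψi⟩ := H.exists_local_section hw₁ hp₁
  -- No regularity of `φ` is given; near a regular value it is the height composed with a smooth
  -- local section.
  obtain ⟨q, hq⟩ : ∃ q : ℂ →L[ℝ] ℝ, HasFDerivAt φ q (harmonicMap h k w₁) := by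
    have h1 := H.hasFDerivAt_comp_section (C := fun w => 2 * l * G w) hT
      (hψc.differentiableAt two_ne_zero) (by rwa [hψ]) hψi
    have h2 := Complex.reCLM.hasFDerivAt.comp _ h1
    refine ⟨_, h2.congr_of_eventuallyEq ?_⟩
    have h3 : ∀ᶠ y in 𝓝 (harmonicMap h k w₁), ψ y ∈ D :=
      hψc.continuousAt (by rw [hψ]; exact H.isOpen.mem_nhds hw₁)
    filter_upwards [hψi, h3] with y hy hyD
    have := hφ _ hyD
    rw [hy] at this
    exact this.symm
  -- `Q` represents the differential by `q ξ = Re (Q ξ)`. The chain rule at any regular preimage of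
  -- the point gives the same quadratic equation for `G`.
  set Q : ℂ := ⟨q 1, -q Complex.I⟩ with hQ
  have key : ∀ w ∈ D, p w ≠ 0 → harmonicMap h k w = harmonicMap h k w₁ →
      Q - starRingEnd ℂ Q * (t * G w ^ 2) = 2 * l * G w := by
    intro w hw hp he
    rw [← he] at hq
    have h1 := hq.comp w (H.hasFDerivAt hw)
    have h2 := Complex.reCLM.hasFDerivAt.comp w (hT w hw).complexToReal_fderiv
    have h3 := h1.unique (h2.congr_of_eventuallyEq (by
      filter_upwards [H.isOpen.mem_nhds hw] with z hz using (hφ z hz).symm))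
    have h4 : ∀ ξ : ℂ, q (beltramiMap (starRingEnd ℂ (t * G w ^ 2)) ξ) = (2 * l * G w * ξ).re := by
      intro ξ
      have := congrArg (fun L : ℂ →L[ℝ] ℝ => L ((p w)⁻¹ * ξ)) h3
      simp only [ContinuousLinearMap.comp_apply, smul_apply,
        one_apply_eq_self, smul_eq_mul, mul_inv_cancel_left₀ hp,
        Complex.reCLM_apply, hμ w hw] at this
      rw [this, mul_assoc _ (p w), mul_inv_cancel_left₀ hp]
    have hqz : ∀ ξ : ℂ, q ξ = (Q * ξ).re := by
      intro ξ
      have h5 : ξ = ξ.re • (1 : ℂ) + ξ.im • Complex.I := by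
        apply Complex.ext <;> simp
      conv_lhs => rw [h5, map_add, map_smul, map_smul]
      simp [hQ, Complex.mul_re]; ring
    have h6 : ∀ ξ : ℂ, ((Q - starRingEnd ℂ Q * (t * G w ^ 2)) * ξ).re = (2 * l * G w * ξ).re := by
      intro ξ
      rw [← h4, hqz, beltramiMap_apply, mul_sub, sub_mul, Complex.sub_re, Complex.sub_re]
      congr 1
      rw [← Complex.conj_re]
      simp only [map_mul, Complex.conj_conj]
      ring_nf
    apply Complex.ext
    · simpa using h6 1
    · have := h6 Complex.I
      simpa only [Complex.mul_I_re, neg_inj] using this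
  have hn : ∀ w ∈ D, ‖(t : ℂ) * G w ^ 2‖ < 1 := fun w hw => by
    rw [← hμ w hw]; exact H.norm_dilatation_lt w hw
  exact gauss_eq_of_gradient_eq hl (hn _ hw₁) (hn _ hw₂) (key w₁ hw₁ hp₁ rfl)
    (key w₂ hw₂ hp₂ heq.symm)

/-- A holomorphic function whose differential descends along a harmonic map onto a convex domain
factors through that map. -/
theorem exists_factor (H : IsHarmonicPair D h k p μ) (hc : Convex ℝ (harmonicMap h k '' D))
    {γ σ K : ℂ → ℂ} (hγ : ContinuousOn γ (harmonicMap h k '' D))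
    (hσ : ContinuousOn σ (harmonicMap h k '' D))
    (hσμ : ∀ w ∈ D, σ (harmonicMap h k w) = starRingEnd ℂ (μ w))
    (hK : ∀ w ∈ D, HasDerivAt K (γ (harmonicMap h k w) * p w) w) :
    ∃ L : ℂ → ℂ, (∀ z ∈ harmonicMap h k '' D, HasFDerivAt L (γ z • beltramiInv (σ z)) z) ∧
      ∀ w ∈ D, K w = L (harmonicMap h k w) := by
  set f := harmonicMap h k with hf
  set ω : ℂ → ℂ →L[ℝ] ℂ := fun z => γ z • beltramiInv (σ z) with hω
  have hσ1 : ∀ z ∈ f '' D, ‖σ z‖ < 1 := by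
    rintro _ ⟨w, hw, rfl⟩
    rw [hσμ w hw]
    exact H.norm_conj_dilatation_lt hw
  have hωc : ContinuousOn ω (f '' D) :=
    hγ.smul fun z hz => (continuousAt_beltramiInv (hσ1 z hz)).comp_continuousWithinAt (hσ z hz)
  have hKd : DifferentiableOn ℂ K D := fun w hw =>
    (hK w hw).differentiableAt.differentiableWithinAt
  -- Near a regular value `ω` is the differential of `K ∘ ψ` for a local section `ψ`, hence closed.
  have hloc : ∀ z ∈ f '' D \ f '' {w ∈ D | p w = 0},
      ∃ κ : ℂ → ℂ, ContDiffAt ℝ 2 κ z ∧ fderiv ℝ κ =ᶠ[𝓝 z] ω := by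
    rintro _ ⟨⟨w, hw, rfl⟩, hwp⟩
    have hp : p w ≠ 0 := fun h0 => hwp ⟨w, ⟨hw, h0⟩, rfl⟩
    obtain ⟨ψ, hψ, hψc, hψi⟩ := H.exists_local_section hw hp
    refine ⟨fun y => K (ψ y), ContDiffAt.comp _ ?_ hψc, ?_⟩
    · rw [hψ]
      exact contDiffAt_of_differentiableOn H.isOpen hKd hw
    · have h3 : ∀ᶠ y in 𝓝 (f w), ψ y ∈ D :=
        hψc.continuousAt (by rw [hψ]; exact H.isOpen.mem_nhds hw)
      have h4 : ∀ᶠ y in 𝓝 (f w), ContDiffAt ℝ 2 ψ y := hψc.eventually (by simp)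
      filter_upwards [h3, h4, hψi.eventually_nhds, hψi] with y hyD hyc hyi hyi'
      have h5 := (H.hasFDerivAt_comp_section (C := fun w => γ (f w)) hK
        (hyc.differentiableAt two_ne_zero) hyD hyi).fderiv
      rw [h5, ← hσμ _ hyD]
      have h6 : f (ψ y) = y := hyi'
      rw [h6]
  obtain ⟨L, hL⟩ := exists_primitive_of_off_countable hc H.isOpen_image
    (H.countable_zeros.image f) hωc (dω := fderiv ℝ ω) (fun z hz => by
      obtain ⟨κ, hκ, hκω⟩ := hloc z hz
      have h1 : DifferentiableAt ℝ (fderiv ℝ κ) z :=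
        (hκ.fderiv_right (m := 1) (by norm_num)).differentiableAt one_ne_zero
      exact (h1.congr_of_eventuallyEq hκω.symm).hasFDerivAt) (fun z hz u v => by
      obtain ⟨κ, hκ, hκω⟩ := hloc z hz
      rw [← hκω.fderiv_eq]
      exact hκ.isSymmSndFDerivAt (by simp) u v)
  have hdiff : ∀ w ∈ D, HasFDerivAt (fun w => K w - L (f w)) (0 : ℂ →L[ℝ] ℂ) w := by
    intro w hw
    refine ((hK w hw).complexToReal_fderiv.sub ((hL _ ⟨w, hw, rfl⟩).comp w
      (H.hasFDerivAt hw))).congr_fderiv (ContinuousLinearMap.ext fun u => ?_)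
    simp only [hω, sub_apply, ContinuousLinearMap.comp_apply,
      smul_apply, one_apply_eq_self, smul_eq_mul,
      zero_apply]
    rw [hσμ w hw, beltramiInv_beltramiMap (H.norm_conj_dilatation_lt hw)]
    ring
  obtain ⟨a, ha⟩ := H.isOpen.exists_is_const_of_fderiv_eq_zero H.isPreconnected (𝕜 := ℝ)
    (fun w hw => (hdiff w hw).differentiableAt.differentiableWithinAt)
    (fun w hw => (hdiff w hw).fderiv)
  refine ⟨fun z => L z + a, fun z hz => (hL z hz).add_const a, fun w hw => ?_⟩
  rw [← ha w hw]; ring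

/-- For a graph over a convex domain, the holomorphic data factor through the harmonic
projection. -/
theorem exists_factor_of_graph (H : IsHarmonicPair D h k p μ)
    (hc : Convex ℝ (harmonicMap h k '' D)) {T G : ℂ → ℂ} {t l : ℝ} (hl : l ≠ 0)
    (hG : ContinuousOn G D) (hT : ∀ w ∈ D, HasDerivAt T (2 * l * G w * p w) w)
    (hμ : ∀ w ∈ D, μ w = t * G w ^ 2) {φ : ℂ → ℝ}
    (hφ : ∀ w ∈ D, (T w).re = φ (harmonicMap h k w)) :
    ∃ h' T' σ : ℂ → ℂ,
      (∀ z ∈ harmonicMap h k '' D, ‖σ z‖ < 1 ∧ HasFDerivAt h' (beltramiInv (σ z)) z) ∧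
      ∀ w ∈ D, h w = h' (harmonicMap h k w) ∧ T w = T' (harmonicMap h k w) := by
  obtain ⟨g, hgc, hg⟩ := H.exists_continuousOn_descent hG (H.eq_of_harmonicMap_eq hG
    fun w₁ hw₁ w₂ hw₂ hp₁ hp₂ he => H.gauss_eq_of_graph hl hT hμ hφ hw₁ hw₂ hp₁ hp₂ he)
  set σ : ℂ → ℂ := fun z => starRingEnd ℂ (t * g z ^ 2) with hσ
  have hσc : ContinuousOn σ (harmonicMap h k '' D) :=
    Complex.continuous_conj.comp_continuousOn (continuousOn_const.mul (hgc.pow 2))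
  have hσμ : ∀ w ∈ D, σ (harmonicMap h k w) = starRingEnd ℂ (μ w) := fun w hw => by
    rw [hμ w hw, hσ]
    simp only [hg w hw]
  obtain ⟨h', hh', hh⟩ := H.exists_factor hc (γ := fun _ => 1) (K := h) continuousOn_const hσc hσμ
    (fun w hw => by simpa using H.hasDerivAt_h w hw)
  obtain ⟨T', -, hT'⟩ := H.exists_factor hc (γ := fun z => 2 * l * g z) (K := T)
    (continuousOn_const.mul hgc) hσc hσμ (fun w hw => by simpa only [hg w hw] using hT w hw)
  refine ⟨h', T', σ, ?_, fun w hw => ⟨hh w hw, hT' w hw⟩⟩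
  intro z hz
  refine ⟨?_, by simpa using hh' z hz⟩
  obtain ⟨w, hw, rfl⟩ := hz
  rw [hσμ w hw]
  exact H.norm_conj_dilatation_lt hw

end IsHarmonicPair

end Factorization

/-! ### Monotonicity of the deformed projections. -/

section Deformation

open scoped InnerProductSpace Topology
open Filter

theorem strictMonotoneField_of_hasFDerivAt {E : Type*} [NormedAddCommGroup E]
    [InnerProductSpace ℝ E] {Ω : Set E} (hΩ : Convex ℝ Ω) {f : E → E} {f' : E → E →L[ℝ] E}
    (hf : ∀ z ∈ Ω, HasFDerivAt f (f' z) z) (hpos : ∀ z ∈ Ω, ∀ u ≠ 0, 0 < ⟪f' z u, u⟫_ℝ) :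
    StrictMonotoneField f Ω := by
  intro x hx y hy hxy
  have hu : x - y ≠ 0 := sub_ne_zero.2 hxy
  have hmem : ∀ s ∈ Icc (0 : ℝ) 1, y + s • (x - y) ∈ Ω := fun s hs =>
    hΩ.add_smul_sub_mem hy hx hs
  have hd : ∀ s ∈ Icc (0 : ℝ) 1, HasDerivAt (fun s : ℝ => ⟪f (y + s • (x - y)), x - y⟫_ℝ)
      ⟪f' (y + s • (x - y)) (x - y), x - y⟫_ℝ s := by
    intro s hs
    have h1 : HasDerivAt (fun s : ℝ => y + s • (x - y)) (x - y) s := by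
      simpa using ((hasDerivAt_id s).smul_const (x - y)).const_add y
    have h2 := (hf _ (hmem s hs)).comp_hasDerivAt s h1
    simpa using h2.inner ℝ (hasDerivAt_const s (x - y))
  have hmono : StrictMonoOn (fun s : ℝ => ⟪f (y + s • (x - y)), x - y⟫_ℝ) (Icc 0 1) := by
    refine strictMonoOn_of_deriv_pos (convex_Icc 0 1)
      (fun s hs => (hd s hs).continuousAt.continuousWithinAt) fun s hs => ?_
    rw [(hd s (interior_subset hs)).deriv]
    exact hpos _ (hmem s (interior_subset hs)) _ hu
  have h3 := hmono (left_mem_Icc.2 zero_le_one) (right_mem_Icc.2 zero_le_one) zero_lt_one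
  simp only [zero_smul, add_zero, one_smul, add_sub_cancel] at h3
  rw [inner_sub_left]
  linarith

/-- The real part is at least `|u|² / (1 + |σ|)`, because `(1 - |σ|) / (1 - |σ|²) = 1 / (1 + |σ|)`.
-/
theorem half_normSq_lt_re_conj_mul_beltramiInv {σ : ℂ} (hσ : ‖σ‖ < 1) {u : ℂ} (hu : u ≠ 0) :
    Complex.normSq u / 2 < (starRingEnd ℂ u * beltramiInv σ u).re := by
  have h0 := one_sub_normSq_pos hσ
  have h1 : starRingEnd ℂ u * beltramiInv σ u =
      ((1 - Complex.normSq σ)⁻¹ : ℝ) * (Complex.normSq u + σ * starRingEnd ℂ u ^ 2) := by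
    rw [beltramiInv_apply, ← Complex.mul_conj u]
    push_cast; ring
  have h2 : -(‖σ‖ * Complex.normSq u) ≤ (σ * starRingEnd ℂ u ^ 2).re := by
    have h3 := (abs_le.1 (Complex.abs_re_le_norm (σ * starRingEnd ℂ u ^ 2))).1
    rwa [norm_mul, norm_pow, RCLike.norm_conj, ← Complex.normSq_eq_norm_sq] at h3
  have hu' : 0 < Complex.normSq u := Complex.normSq_pos.2 hu
  rw [h1, Complex.re_ofReal_mul, Complex.add_re, Complex.ofReal_re, lt_inv_mul_iff₀ h0]
  rw [Complex.normSq_eq_norm_sq σ]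
  nlinarith [norm_nonneg σ, mul_pos hu' (mul_pos (sub_pos.2 hσ) (sub_pos.2 hσ))]

/-- Convex combinations `(1 - ε) A + ε` with `Re A > 1 / 2` and `|ε| ≤ 1` are positive after a
rotation by `conj (1 - ε)`. -/
theorem re_pos_of_half_lt {ε a : ℂ} (hε : ‖ε‖ ≤ 1) (hε1 : ε ≠ 1) {n : ℝ}
    (ha : n / 2 < a.re) (hn : 0 < n) :
    0 < (starRingEnd ℂ (1 - ε) * ((1 - ε) * a + ε * n)).re := by
  have h1 : 0 < Complex.normSq (1 - ε) := Complex.normSq_pos.2 (sub_ne_zero.2 hε1.symm)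
  have h2 : Complex.normSq ε ≤ 1 := by
    rw [Complex.normSq_eq_norm_sq]
    nlinarith [norm_nonneg ε]
  have h3 : starRingEnd ℂ (1 - ε) * ((1 - ε) * a + ε * n) =
      (Complex.normSq (1 - ε) : ℂ) * a + (starRingEnd ℂ (1 - ε) * ε) * n := by
    rw [← Complex.mul_conj]; ring
  rw [h3, Complex.add_re, Complex.re_ofReal_mul, Complex.re_mul_ofReal]
  have h4 : (starRingEnd ℂ (1 - ε) * ε).re = ε.re - Complex.normSq ε := by
    simp [Complex.normSq_apply, Complex.mul_re]; ring
  have h5 : Complex.normSq (1 - ε) = 1 - 2 * ε.re + Complex.normSq ε := by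
    simp [Complex.normSq_apply]; ring
  rw [h4]
  -- Replacing `a.re` by `n / 2` leaves `n (1 - |ε|²) / 2`, which is nonnegative.
  have h6 := mul_lt_mul_of_pos_left ha h1
  rw [h5] at h6 ⊢
  nlinarith

/-- The deformations `κ ((1 - ε) h + ε z)` of the holomorphic part `h` of a harmonic map with
convex image `Ω` are injective with open close-to-convex image. -/
theorem isCloseToConvex_image_of_beltrami {Ω : Set ℂ} (hΩ : Convex ℝ Ω) (hΩo : IsOpen Ω)
    (hΩn : Ω.Nonempty) {h' σ : ℂ → ℂ}
    (hσ : ∀ z ∈ Ω, ‖σ z‖ < 1 ∧ HasFDerivAt h' (beltramiInv (σ z)) z) {κ ε a : ℂ} (hκ : κ ≠ 0)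
    (hε : ‖ε‖ ≤ 1) {Φ : ℂ → ℂ} (hΦ : ∀ z, Φ z = κ * ((1 - ε) * h' z + ε * z) + a) :
    InjOn Φ Ω ∧ ContinuousOn Φ Ω ∧ IsOpen (Φ '' Ω) ∧ IsCloseToConvex (Φ '' Ω) := by
  -- The rotation is by `β = κ (1 - ε)`; for `ε = 1` the map `Φ` is affine with factor `κ`, so `β =
  -- κ`. Then `y ↦ Φ (β⁻¹ y)` is strictly monotone on the convex set `β Ω`.
  obtain ⟨β, hβ, hpos⟩ : ∃ β : ℂ, β ≠ 0 ∧ ∀ z ∈ Ω, ∀ u ≠ 0,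
      0 < (starRingEnd ℂ (β * u) * (κ * ((1 - ε) * beltramiInv (σ z) u + ε * u))).re := by
    have hκ' : 0 < Complex.normSq κ := Complex.normSq_pos.2 hκ
    by_cases hε1 : ε = 1
    · refine ⟨κ, hκ, fun z hz u hu => ?_⟩
      have h1 : starRingEnd ℂ (κ * u) * (κ * ((1 - ε) * beltramiInv (σ z) u + ε * u)) =
          (Complex.normSq κ * Complex.normSq u : ℝ) := by
        push_cast
        rw [← Complex.mul_conj, ← Complex.mul_conj, hε1, map_mul]; ring
      rw [h1, Complex.ofReal_re]
      exact mul_pos hκ' (Complex.normSq_pos.2 hu)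
    · refine ⟨κ * (1 - ε), mul_ne_zero hκ (sub_ne_zero.2 (Ne.symm hε1)), fun z hz u hu => ?_⟩
      have h1 : starRingEnd ℂ (κ * (1 - ε) * u) *
          (κ * ((1 - ε) * beltramiInv (σ z) u + ε * u)) = (Complex.normSq κ : ℂ) *
          (starRingEnd ℂ (1 - ε) * ((1 - ε) * (starRingEnd ℂ u * beltramiInv (σ z) u) +
            ε * Complex.normSq u)) := by
        rw [← Complex.mul_conj, ← Complex.mul_conj, map_mul, map_mul]; ring
      rw [h1, Complex.re_ofReal_mul]
      exact mul_pos hκ' (re_pos_of_half_lt hε hε1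
        (half_normSq_lt_re_conj_mul_beltramiInv (hσ z hz).1 hu) (Complex.normSq_pos.2 hu))
  set m : ℂ →L[ℝ] ℂ := β⁻¹ • (1 : ℂ →L[ℝ] ℂ) with hm
  have hmap : ∀ y, m y = β⁻¹ * y := fun y => by simp [hm]
  set Ω' : Set ℂ := m ⁻¹' Ω with hΩ'
  have hc' : Convex ℝ Ω' := hΩ.linear_preimage m.toLinearMap
  have ho' : IsOpen Ω' := hΩo.preimage m.continuous
  have hsurj : m '' Ω' = Ω := image_preimage_eq _ fun z => ⟨β * z, by
    rw [hmap, inv_mul_cancel_left₀ hβ]⟩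
  have hΦd : ∀ z ∈ Ω, HasFDerivAt Φ (κ • ((1 - ε) • beltramiInv (σ z) +
      ε • (1 : ℂ →L[ℝ] ℂ))) z := by
    intro z hz
    have h1 : HasFDerivAt (fun z => κ • ((1 - ε) • h' z + ε • z) + a) (κ • ((1 - ε) •
        beltramiInv (σ z) + ε • (1 : ℂ →L[ℝ] ℂ))) z :=
      ((((hσ z hz).2.const_smul (1 - ε)).add ((hasFDerivAt_id z).const_smul ε)).const_smul
        κ).add_const a
    exact h1.congr_of_eventuallyEq (Eventually.of_forall hΦ)
  have hd : ∀ y ∈ Ω', HasFDerivAt (fun y => Φ (m y)) ((κ • ((1 - ε) • beltramiInv (σ (m y)) +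
      ε • (1 : ℂ →L[ℝ] ℂ))).comp m) y := fun y hy => (hΦd _ hy).comp y m.hasFDerivAt
  have hmono : StrictMonotoneField (fun y => Φ (m y)) Ω' := by
    refine strictMonotoneField_of_hasFDerivAt hc' hd fun y hy u hu => ?_
    have h1 := hpos _ hy (β⁻¹ * u) (mul_ne_zero (inv_ne_zero hβ) hu)
    rw [mul_inv_cancel_left₀ hβ] at h1
    rw [real_inner_comm, Complex.inner, mul_comm]
    refine h1.trans_eq (congrArg Complex.re (congrArg _ ?_))
    simp [hmap, mul_add]
  have hcont : ContinuousOn (fun y => Φ (m y)) Ω' := fun y hy =>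
    (hd y hy).continuousAt.continuousWithinAt
  have himg : (fun y => Φ (m y)) '' Ω' = Φ '' Ω := by
    rw [← hsurj, image_image]
  refine ⟨?_, fun z hz => (hΦd z hz).continuousAt.continuousWithinAt, ?_, ?_⟩
  · rw [← hsurj]
    rintro _ ⟨y₁, hy₁, rfl⟩ _ ⟨y₂, hy₂, rfl⟩ he
    rw [hmono.injOn hy₁ hy₂ he]
  · rw [← himg]
    exact hmono.isOpen_image hcont ho'
  · rw [← himg]
    exact hmono.isCloseToConvex_image hcont ho' hc' (by
      obtain ⟨z, hz⟩ := hΩn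
      rw [← hsurj] at hz
      exact hz.imp fun _ h => h.1)

/-- The maximum principle makes the bound strict, so the initial dilatation stays below one even
when `|c₀ λ₀²| = 1 / ‖G‖²`. -/
theorem norm_lt_supNormOn {D : Set ℂ} (hD : IsOpen D) (hDc : IsPreconnected D) {G : ℂ → ℂ}
    (hG : DifferentiableOn ℂ G D) (hGc : ¬ ∃ a : ℂ, ∀ w ∈ D, G w = a)
    (hG1 : ∀ w ∈ D, ‖G w‖ < 1) {w : ℂ} (hw : w ∈ D) : ‖G w‖ < supNormOn D G := by
  have hbdd : BddAbove ((fun w => ‖G w‖) '' D) := ⟨1, by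
    rintro _ ⟨z, hz, rfl⟩; exact (hG1 z hz).le⟩
  refine lt_of_le_of_ne (le_csSup hbdd ⟨w, hw, rfl⟩) fun heq => hGc ⟨G w, ?_⟩
  refine Complex.eqOn_of_isPreconnected_of_isMaxOn_norm hDc hD hG hw fun z hz => ?_
  simp only [Function.comp_apply, mem_ofPred_eq]
  rw [heq]
  exact le_csSup hbdd ⟨z, hz, rfl⟩

theorem abs_mul_norm_sq_lt_one {t g s : ℝ} (hg : 0 ≤ g) (hgs : g < s) (ht : |t| ≤ 1 / s ^ 2) :
    |t| * g ^ 2 < 1 := by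
  have hs : 0 < s ^ 2 := by nlinarith
  rw [le_div_iff₀ hs] at ht
  rcases (abs_nonneg t).eq_or_lt with h | h
  · rw [← h]; norm_num
  · have : g ^ 2 < s ^ 2 := by nlinarith
    nlinarith

/-- The horizontal part of a deformed surface is a harmonic map. -/
theorem harmonicMap_eq_of_isDeformedSurface (Ψ₁ Ψ₂ : ℂ → ℂ) (w : ℂ) :
    harmonicMap (fun w => (Ψ₁ w + Complex.I * Ψ₂ w) / 2) (fun w => (Complex.I * Ψ₂ w - Ψ₁ w) / 2) w =
      ⟨(Ψ₁ w).re, (Ψ₂ w).re⟩ := by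
  apply Complex.ext
  · rw [harmonicMap, Complex.sub_re, Complex.conj_re]
    simp; ring
  · rw [harmonicMap, Complex.sub_im, Complex.conj_im]
    simp; ring

theorem hasDerivAt_half_add {Ψ₁ Ψ₂ : ℂ → ℂ} {q m w : ℂ} (h₁ : HasDerivAt Ψ₁ ((1 - m) * q) w)
    (h₂ : HasDerivAt Ψ₂ (-Complex.I * (1 + m) * q) w) :
    HasDerivAt (fun w => (Ψ₁ w + Complex.I * Ψ₂ w) / 2) q w := by
  convert! (h₁.add (h₂.const_mul Complex.I)).div_const 2 using 1
  linear_combination ((1 + m) * q / 2) * Complex.I_sq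

theorem hasDerivAt_half_sub {Ψ₁ Ψ₂ : ℂ → ℂ} {q m w : ℂ} (h₁ : HasDerivAt Ψ₁ ((1 - m) * q) w)
    (h₂ : HasDerivAt Ψ₂ (-Complex.I * (1 + m) * q) w) :
    HasDerivAt (fun w => (Complex.I * Ψ₂ w - Ψ₁ w) / 2) (m * q) w := by
  convert! ((h₂.const_mul Complex.I).sub h₁).div_const 2 using 1
  linear_combination ((1 + m) * q / 2) * Complex.I_sq

theorem exists_eq_mul_add_of_hasDerivAt {D : Set ℂ} (hD : IsOpen D) (hDc : IsPreconnected D)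
    {f g f' g' : ℂ → ℂ} {m : ℂ} (hf : ∀ w ∈ D, HasDerivAt f (f' w) w)
    (hg : ∀ w ∈ D, HasDerivAt g (g' w) w) (he : ∀ w ∈ D, f' w = m * g' w) :
    ∃ a, ∀ w ∈ D, f w = m * g w + a := by
  obtain ⟨a, ha⟩ := hD.exists_is_const_of_deriv_eq_zero hDc (f := fun w => f w - m * g w)
    (fun w hw => ((hf w hw).sub
      ((hg w hw).const_mul m)).differentiableAt.differentiableWithinAt) (fun w hw => by
    refine ((hf w hw).sub ((hg w hw).const_mul m)).deriv.trans ?_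
    rw [he w hw, sub_self]; rfl)
  exact ⟨a, fun w hw => by rw [← ha w hw]; ring⟩

end Deformation

/-! ### The deformation theorem for graphs over convex domains. -/

theorem theorem1p2 (D : Set ℂ) (hDo : IsOpen D) (hDs : IsSimplyConnected D) (hDp : D ≠ univ)
    (F G : ℂ → ℂ) (hF : DifferentiableOn ℂ F D) (hF0 : ∃ w ∈ D, F w ≠ 0)
    (hG : DifferentiableOn ℂ G D) (hGc : ¬ ∃ a : ℂ, ∀ w ∈ D, G w = a)
    (hG1 : ∀ w ∈ D, ‖G w‖ < 1)
    (θ₀ l₀ c₀ : ℝ) (hl₀ : 0 < l₀) (hb : |c₀ * l₀ ^ 2| ≤ 1 / supNormOn D G ^ 2)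
    (X₀ : ℂ → ℂ × ℝ) (hX₀ : IsDeformedSurface D F G θ₀ l₀ c₀ X₀)
    (hgraph : ∃ Ω₀ : Set ℂ, Convex ℝ Ω₀ ∧ IsGraphOverDomain (X₀ '' D) Ω₀)
    (θ l c : ℝ) (hl : 0 < l) (hc : |c * l ^ 2| ≤ |c₀ * l₀ ^ 2|)
    (X : ℂ → ℂ × ℝ) (hX : IsDeformedSurface D F G θ l c X) :
    ∃ Ω : Set ℂ, IsCloseToConvex Ω ∧ IsGraphOverDomain (X '' D) Ω := by
  have hDc : IsPreconnected D := hDs.isPathConnected.isConnected.isPreconnected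
  obtain ⟨A₁, A₂, A₃, hA₁, hA₂, hA₃, hA⟩ := hX₀
  obtain ⟨B₁, B₂, B₃, hB₁, hB₂, hB₃, hB⟩ := hX
  obtain ⟨Ω₀, hΩ₀c, hΩ₀o, hΩ₀n, φ, hφ⟩ := hgraph
  set a₀ : ℂ := Complex.exp (Complex.I * θ₀) / l₀ with ha₀
  set a₁ : ℂ := Complex.exp (Complex.I * θ) / l with ha₁
  have hl₀' : (l₀ : ℂ) ≠ 0 := Complex.ofReal_ne_zero.2 hl₀.ne'
  have hl' : (l : ℂ) ≠ 0 := Complex.ofReal_ne_zero.2 hl.ne'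
  have ha₀0 : a₀ ≠ 0 := div_ne_zero (Complex.exp_ne_zero _) hl₀'
  have ha₁0 : a₁ ≠ 0 := div_ne_zero (Complex.exp_ne_zero _) hl'
  set h := fun w => (A₁ w + Complex.I * A₂ w) / 2 with hh
  set k := fun w => (Complex.I * A₂ w - A₁ w) / 2 with hk
  set h₁ := fun w => (B₁ w + Complex.I * B₂ w) / 2 with hh₁
  set k₁ := fun w => (Complex.I * B₂ w - B₁ w) / 2 with hk₁
  have dh : ∀ w ∈ D, HasDerivAt h (a₀ * F w) w := fun w hw =>
    hasDerivAt_half_add (m := c₀ * l₀ ^ 2 * G w ^ 2) (by simpa only [mul_assoc] using hA₁ w hw)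
      (by simpa only [mul_assoc] using hA₂ w hw)
  have dk : ∀ w ∈ D, HasDerivAt k (c₀ * l₀ ^ 2 * G w ^ 2 * (a₀ * F w)) w := fun w hw =>
    hasDerivAt_half_sub (by simpa only [mul_assoc] using hA₁ w hw)
      (by simpa only [mul_assoc] using hA₂ w hw)
  have dh₁ : ∀ w ∈ D, HasDerivAt h₁ (a₁ * F w) w := fun w hw =>
    hasDerivAt_half_add (m := c * l ^ 2 * G w ^ 2) (by simpa only [mul_assoc] using hB₁ w hw)
      (by simpa only [mul_assoc] using hB₂ w hw)
  have dk₁ : ∀ w ∈ D, HasDerivAt k₁ (c * l ^ 2 * G w ^ 2 * (a₁ * F w)) w := fun w hw =>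
    hasDerivAt_half_sub (by simpa only [mul_assoc] using hB₁ w hw)
      (by simpa only [mul_assoc] using hB₂ w hw)
  have H : IsHarmonicPair D h k (fun w => a₀ * F w) (fun w => c₀ * l₀ ^ 2 * G w ^ 2) := by
    refine ⟨hDo, hDc, dh, dk, (hG.pow 2).const_mul _, fun w hw => ?_, ?_⟩
    · have := abs_mul_norm_sq_lt_one (norm_nonneg _) (norm_lt_supNormOn hDo hDc hG hGc hG1 hw) hb
      rwa [norm_mul, norm_pow, ← Complex.ofReal_pow, ← Complex.ofReal_mul, Complex.norm_real,
        Real.norm_eq_abs]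
    · exact hF0.imp fun w hw => ⟨hw.1, mul_ne_zero ha₀0 hw.2⟩
  set f := harmonicMap h k with hf
  have hA' : ∀ w ∈ D, X₀ w = (f w, (A₃ w).re) := fun w hw => by
    rw [hA w hw, hf, harmonicMap_eq_of_isDeformedSurface]
  have hB' : ∀ w ∈ D, X w = (harmonicMap h₁ k₁ w, (B₃ w).re) := fun w hw => by
    rw [hB w hw, harmonicMap_eq_of_isDeformedSurface]
  have hgr : ∀ w ∈ D, f w ∈ Ω₀ ∧ (A₃ w).re = φ (f w) := fun w hw => by
    have h1 : X₀ w ∈ X₀ '' D := ⟨w, hw, rfl⟩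
    rw [hφ, hA' w hw] at h1
    exact h1
  have hfD : f '' D = Ω₀ := by
    apply Subset.antisymm
    · rintro _ ⟨w, hw, rfl⟩
      exact (hgr w hw).1
    · intro z hz
      have h1 : (z, φ z) ∈ X₀ '' D := by rw [hφ]; exact ⟨hz, rfl⟩
      obtain ⟨w, hw, he⟩ := h1
      rw [hA' w hw] at he
      exact ⟨w, hw, congrArg Prod.fst he⟩
  obtain ⟨h', T', σ, hσ, hfac⟩ := H.exists_factor_of_graph (T := A₃) (t := c₀ * l₀ ^ 2)
    (by rwa [← hf, hfD]) hl₀.ne' hG.continuousOn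
    (fun w hw => by simpa only [mul_assoc] using hA₃ w hw)
    (fun w _ => by push_cast; rfl) (fun w hw => (hgr w hw).2)
  rw [← hf, hfD] at hσ
  set κ : ℂ := a₁ / a₀ with hκ
  have hκ0 : κ ≠ 0 := div_ne_zero ha₁0 ha₀0
  have hκa : a₁ = κ * a₀ := (div_mul_cancel₀ a₁ ha₀0).symm
  set r : ℝ := c * l ^ 2 / (c₀ * l₀ ^ 2) with hr
  have hr1 : |r| ≤ 1 := by
    rw [hr, abs_div]
    exact div_le_one_of_le₀ hc (abs_nonneg _)
  -- If `c₀ = 0`, then also `c = 0`, and division by zero gives the harmless value `r = 0`.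
  have hrt : c * l ^ 2 = r * (c₀ * l₀ ^ 2) := by
    by_cases h0 : c₀ * l₀ ^ 2 = 0
    · rw [h0, abs_zero] at hc
      rw [h0, mul_zero, abs_nonpos_iff.1 hc]
    · rw [hr, div_mul_cancel₀ _ h0]
  obtain ⟨b₁, hb₁⟩ := exists_eq_mul_add_of_hasDerivAt hDo hDc (m := κ) dh₁ dh fun w _ => by
    rw [hκa]; ring
  obtain ⟨b₂, hb₂⟩ := exists_eq_mul_add_of_hasDerivAt hDo hDc (m := κ * r) dk₁ dk fun w _ => by
    have hrt' : (c : ℂ) * l ^ 2 = r * (c₀ * l₀ ^ 2) := by exact_mod_cast hrt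
    rw [hκa, hrt']; ring
  obtain ⟨b₃, hb₃⟩ := exists_eq_mul_add_of_hasDerivAt hDo hDc (m := κ * (l / l₀)) hB₃ hA₃
    fun w _ => by rw [hκa]; field_simp
  -- Chosen so that `κ ε = conj κ r`: this turns the conjugate of `κ r k` into `κ ε (h - f)`.
  set ε : ℂ := starRingEnd ℂ κ / κ * r with hε
  have hε1 : ‖ε‖ ≤ 1 := by
    rw [hε, norm_mul, norm_div, RCLike.norm_conj, div_self (norm_ne_zero_iff.2 hκ0), one_mul,
      Complex.norm_real, Real.norm_eq_abs]
    exact hr1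
  set Φ : ℂ → ℂ := fun z => κ * ((1 - ε) * h' z + ε * z) + (b₁ - starRingEnd ℂ b₂) with hΦ
  have hΦf : ∀ w ∈ D, harmonicMap h₁ k₁ w = Φ (f w) := by
    intro w hw
    have hκε : κ * ε = starRingEnd ℂ κ * r := by
      rw [hε]; field_simp
    have h1 : f w = h w - starRingEnd ℂ (k w) := rfl
    have h2 : harmonicMap h₁ k₁ w = h₁ w - starRingEnd ℂ (k₁ w) := rfl
    rw [h2, hb₁ w hw, hb₂ w hw]
    simp only [hΦ, map_add, map_mul, Complex.conj_ofReal]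
    rw [← (hfac w hw).1, h1]
    linear_combination starRingEnd ℂ (k w) * hκε
  obtain ⟨hinj, hcont, hopen, hctc⟩ := isCloseToConvex_image_of_beltrami hΩ₀c hΩ₀o hΩ₀n.nonempty
    hσ hκ0 hε1 (Φ := Φ) (fun z => rfl)
  refine ⟨Φ '' Ω₀, hctc, hopen, hΩ₀n.image Φ hcont,
    -- The new height is an affine function of the old holomorphic height, which factors through
    -- `f`; injectivity of `Φ` makes it a function of the new base point.
    fun x => (κ * (l / l₀) * T' (Function.invFunOn Φ Ω₀ x) + b₃).re, ?_⟩
  have hX' : ∀ w ∈ D, X w = (Φ (f w), (κ * (l / l₀) * T' (f w) + b₃).re) := fun w hw => by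
    rw [hB' w hw, hΦf w hw, hb₃ w hw, (hfac w hw).2]
  have hinv : ∀ z ∈ Ω₀, Function.invFunOn Φ Ω₀ (Φ z) = z := fun z hz =>
    hinj.leftInvOn_invFunOn hz
  ext ⟨x, y⟩
  constructor
  · rintro ⟨w, hw, he⟩
    rw [hX' w hw] at he
    obtain ⟨rfl, rfl⟩ := Prod.mk.inj he
    refine ⟨⟨f w, (hgr w hw).1, rfl⟩, ?_⟩
    dsimp only
    rw [hinv _ (hgr w hw).1]
  · rintro ⟨⟨z, hz, hzx⟩, hy⟩
    obtain ⟨w, hw, rfl⟩ := hfD.symm.subset hz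
    dsimp only at hzx hy
    refine ⟨w, hw, ?_⟩
    rw [hX' w hw, hy, ← hzx, hinv _ hz]
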